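/- Let $k$ be a field of characteristic different from $2$ and $3$ containing a primitive third root of unity $\omega$, and let $$A = k\langle x,y\rangle/\left(x^3y=yx^3,\ xy^3=y^3x,\ x^2y^2+(xy)^2=y^2x^2+(yx)^2\right).$$ Put $\alpha=x^2y+xyx+yx^2$, $\beta=xy^2+yxy+y^2x$, $\gamma=(xy)^2-y^2x^2$, $\delta=yx-\omega xy$ and $$s=\delta^3-\tfrac12\left(3\omega(1-\omega)x^3y^3+(1+2\omega^2)\alpha\beta\right)\in A.$$ Identify $\mathbb A^4=\operatorname{Spec}k[a,b,c,d]$ with the space of binary cubic forms $au^3+bu^2v+cuv^2+dv^3$, and let $\Delta(a,b,c,d)=b^2c^2-4ac^3-4b^3d-27a^2d^2+18abcd$ be the discriminant. 1. The center of $A$ is the subalgebra $k[x^3,y^3,\alpha,\beta,\gamma,\delta^3]$ of $A$ generated by $x^3,y^3,\alpha,\beta,\gamma,\delta^3$. 2. The center is the affine coordinate ring of the relative curve $s^2=\gamma^3+\tfrac14\Delta(x^3,\alpha,\beta,y^3)$ over $\mathbb A^4$. That is, there is an isomorphism of $k$-algebras from $k[a,b,c,d][g,t]/\left(t^2-g^3-\tfrac14\Delta(a,b,c,d)\right)$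 to the center of $A$ that sends $a,b,c,d,g,t$ to $x^3,\alpha,\beta,y^3,\gamma,s$ respectively; and the spectrum of this ring is a relative curve over $\mathbb A^4$ (an affine, hence quasi-projective, flat morphism of finite presentation whose fibres are geometrically integral of dimension $1$). 3. The set $U\subset\mathbb A^4$ of nondegenerate forms (the points at which the form over the residue field is, over an algebraic closure, a product of three pairwise non-proportional linear forms) is the dense open set $\Delta\neq0$. The relative curve is elliptic over $U$: its restriction to $U$ is the affine part (the complement of the zero section) of the elliptic curve over $U$ given by the Weierstrass equation $t^2=g^3+\tfrac14\Delta$, whose Weierstrass discriminant is invertible on $U$. -/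

import Mathlib

open CategoryTheory AlgebraicGeometry

universe u

noncomputable section

namespace CubicClifford

/-! ### The binary cubic generic Clifford algebra -/

section Algebra

variable (k : Type u) [Field k]

/-- The three defining relations `x³y = yx³`, `xy³ = y³x`,
`x²y² + (xy)² = y²x² + (yx)²` on the free algebra on `x = ι 0`, `y = ι 1`. -/
inductive Rel : FreeAlgebra k (Fin 2) → FreeAlgebra k (Fin 2) → Prop
  | cube_left :
      Rel (FreeAlgebra.ι k 0 ^ 3 * FreeAlgebra.ι k 1) (FreeAlgebra.ι k 1 * FreeAlgebra.ι k 0 ^ 3)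
  | cube_right :
      Rel (FreeAlgebra.ι k 0 * FreeAlgebra.ι k 1 ^ 3) (FreeAlgebra.ι k 1 ^ 3 * FreeAlgebra.ι k 0)
  | square :
      Rel (FreeAlgebra.ι k 0 ^ 2 * FreeAlgebra.ι k 1 ^ 2
            + (FreeAlgebra.ι k 0 * FreeAlgebra.ι k 1) ^ 2)
        (FreeAlgebra.ι k 1 ^ 2 * FreeAlgebra.ι k 0 ^ 2
            + (FreeAlgebra.ι k 1 * FreeAlgebra.ι k 0) ^ 2)

/-- The algebra `A = k⟨x, y⟩ / (x³y = yx³, xy³ = y³x, x²y² + (xy)² = y²x² + (yx)²)`. -/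
abbrev A : Type u := RingQuot (Rel k)

/-- The generator `x` of `A`. -/
def x : A k := RingQuot.mkAlgHom k (Rel k) (FreeAlgebra.ι k 0)

/-- The generator `y` of `A`. -/
def y : A k := RingQuot.mkAlgHom k (Rel k) (FreeAlgebra.ι k 1)

/-- `α = x²y + xyx + yx²`. -/
def α : A k := x k ^ 2 * y k + x k * y k * x k + y k * x k ^ 2

/-- `β = xy² + yxy + y²x`. -/
def β : A k := x k * y k ^ 2 + y k * x k * y k + y k ^ 2 * x k

/-- `γ = (xy)² - y²x²`. -/
def γ : A k := (x k * y k) ^ 2 - y k ^ 2 * x k ^ 2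

variable {k}

/-- `δ = yx - ωxy`. -/
def δ (ω : k) : A k := y k * x k - ω • (x k * y k)

/-- `s = δ³ - (3ω(1 - ω) x³y³ + (1 + 2ω²) αβ) / 2`. -/
def s (ω : k) : A k :=
  δ ω ^ 3 - (2 : k)⁻¹ •
    ((3 * ω * (1 - ω)) • (x k ^ 3 * y k ^ 3) + (1 + 2 * ω ^ 2) • (α k * β k))

end Algebra

/-! ### Binary cubic forms -/

/-- The binary cubic form `a u³ + b u²v + c uv² + d v³` with the coefficients of `f`. -/
def binaryForm {R : Type u} [CommRing R] (f : Cubic R) : MvPolynomial (Fin 2) R :=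
  MvPolynomial.C f.a * MvPolynomial.X 0 ^ 3
    + MvPolynomial.C f.b * MvPolynomial.X 0 ^ 2 * MvPolynomial.X 1
    + MvPolynomial.C f.c * MvPolynomial.X 0 * MvPolynomial.X 1 ^ 2
    + MvPolynomial.C f.d * MvPolynomial.X 1 ^ 3

/-- A binary cubic form over a field is nondegenerate if over an algebraic closure it is
a product of three pairwise non-proportional linear forms `pᵢ u + qᵢ v`. -/
def IsNondegenerate {K : Type u} [Field K] (f : Cubic K) : Prop :=
  ∃ p q : Fin 3 → AlgebraicClosure K,
    (∀ i j, i ≠ j → p i * q j ≠ p j * q i) ∧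
    binaryForm (f.map (algebraMap K (AlgebraicClosure K))) =
      ∏ i, (MvPolynomial.C (p i) * MvPolynomial.X 0 + MvPolynomial.C (q i) * MvPolynomial.X 1)

section Curve

variable (k : Type u) [Field k]

/-- The coordinate ring `k[a, b, c, d]` of the affine space of binary cubic forms. -/
abbrev FormRing : Type u := MvPolynomial (Fin 4) k

/-- Affine four-space over `k`, the space of binary cubic forms. -/
abbrev FormSpace : Scheme.{u} := Spec (CommRingCat.of (FormRing k))

/-- The generic binary cubic form `a u³ + b u²v + c uv² + d v³`. -/
def genericForm : Cubic (FormRing k) :=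
  ⟨MvPolynomial.X 0, MvPolynomial.X 1, MvPolynomial.X 2, MvPolynomial.X 3⟩

/-- The points of affine four-space at which the form, with coefficients taken in the residue
field, is nondegenerate. -/
def nondegenerateLocus : Set (FormSpace k) :=
  {p : PrimeSpectrum (FormRing k) | IsNondegenerate ((genericForm k).map
    (algebraMap (FormRing k) p.asIdeal.ResidueField))}

/-- The relative Weierstrass curve `s² = γ³ + Δ(a, b, c, d) / 4` over `k[a, b, c, d]`, where
`Δ = b²c² - 4ac³ - 4b³d - 27a²d² + 18abcd` is the discriminant. -/
def curve : WeierstrassCurve.Affine (FormRing k) :=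
  { a₁ := 0, a₂ := 0, a₃ := 0, a₄ := 0
    a₆ := MvPolynomial.C (4 : k)⁻¹ * (genericForm k).discr }

/-- The coordinate function `γ` on the relative curve. -/
def curveγ : (curve k).CoordinateRing :=
  WeierstrassCurve.Affine.CoordinateRing.mk (curve k) (Polynomial.C Polynomial.X)

/-- The coordinate function `s` on the relative curve. -/
def curveS : (curve k).CoordinateRing :=
  WeierstrassCurve.Affine.CoordinateRing.mk (curve k) Polynomial.X

/-- The relative curve with its coefficients restricted to regular functions on the open `U`. -/
def curveOn (U : (FormSpace k).Opens) : WeierstrassCurve.Affine Γ(FormSpace k, U) :=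
  WeierstrassCurve.map (curve k)
    ((Scheme.ΓSpecIso (CommRingCat.of (FormRing k))).inv ≫
      (FormSpace k).presheaf.map (homOfLE le_top).op).hom

end Curve

/-- The affine scheme over `Spec R` defined by a Weierstrass equation over `R`. -/
def affineCurveHom {R : Type u} [CommRing R] (W : WeierstrassCurve.Affine R) :
    Spec (CommRingCat.of W.CoordinateRing) ⟶ Spec (CommRingCat.of R) :=
  Spec.map (CommRingCat.ofHom (algebraMap R W.CoordinateRing))

/-! ### Relative curves -/

/-- A relative affine curve: an affine (so quasi-projective) flat morphism of finite presentation
whose fibres are geometrically integral of dimension one. -/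
structure IsRelativeAffineCurve {X S : Scheme.{u}} (f : X ⟶ S) : Prop where
  isAffineHom : IsAffineHom f
  flat : Flat f
  locallyOfFinitePresentation : LocallyOfFinitePresentation f
  geometricallyIntegral : GeometricallyIntegral f
  dimension_fiber : ∀ p : S, topologicalKrullDim (f.fiber p) = 1

/-- Over the affine open `U`, the morphism `f` is the affine part (the complement of the zero
section) of the elliptic curve given by the Weierstrass equation `W` over the ring of functions
on `U`, whose discriminant is a unit. -/
structure IsEllipticOver {X S : Scheme.{u}} (f : X ⟶ S) (U : S.Opens)
    (W : WeierstrassCurve.Affine Γ(S, U)) : Prop where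
  isAffineOpen : IsAffineOpen U
  isElliptic : WeierstrassCurve.IsElliptic W
  exists_iso : ∃ φ : (f ⁻¹ᵁ U).toScheme ≅ Spec (CommRingCat.of W.CoordinateRing),
    φ.hom ≫ affineCurveHom W = (f ∣_ U) ≫ U.toSpecΓ

end CubicClifford

end

/-!
The relations of `A` say that, with `δ = yx - ωxy`, the elements `α` and `β` are central and

`yx = ωxy + δ`, `δx = ω²xδ + α`, `yδ = ω²δy + β`.

Thus `A` is an algebra over `CoeffRing k = k[α, β]` with three rewriting rules, which put every
element in the form of a combination of the ordered monomials `x ^ i δ ^ j y ^ l`. These monomials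
are a basis: left multiplication by `x` and `y` on a free module with basis `e i j l` is defined by
the formulas that the rules force, the operators satisfy the relations of `A`, and applying the
resulting representation `rep` to `e 0 0 0` recovers the coefficients (`pbwEquiv`).

Filter `A` by the total degree in `x, δ, y`. The leading coefficients of the commutators of
`x ^ i δ ^ j y ^ l` with `x` and `y` are `ω ^ (l + 2j) - 1` and `ω ^ (i + 2j) - 1`, so the leading
exponents of a central element are congruent to each other modulo `3` (`exponents_modEq`). Such a
monomial is also, up to a unit, the leading term of `γ ^ r x ^ (3i') δ ^ (3j') y ^ (3l')`, as `γ`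
has the leading term `(1 - ω) xδy`. Induction on the degree gives the center
(`center_eq_centerGen`).

The Weierstrass equation `s² = γ³ + Δ / 4` is a computation in the monomial basis (`s_sq`), so the
coordinate ring of the curve maps to the center by `coordHom`. The same leading terms
show that `x³, α, β, y³, γ` are algebraically independent (`polyLift_center_injective`). A
Weierstrass coordinate ring is a domain free of rank two over the polynomial ring in `γ`, and every
element divides its norm, so a homomorphism that is injective on the polynomial ring is injective
(`injective_of_injective_comp_algebraMap`).

On the geometric side, the formation of a Weierstrass coordinate ring commutes with base change
(`isPushout_coordinateRing`), and over a field it is a domain of dimension one, being a finite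
extension of a polynomial ring in one variable. Hence the fibres of the curve are geometrically
integral of dimension one, and its restriction to an affine open is the curve over the ring of
functions there. Finally a product of three linear forms `pᵢ u + qᵢ v` has discriminant
`∏ (pᵢ qⱼ - pⱼ qᵢ)²`, and a form with nonzero discriminant splits over an algebraically closed
field, so the nondegenerate locus is `Δ ≠ 0` (`nondegenerateLocus_eq`); the Weierstrass discriminant
`-27 Δ²` is a unit there.
-/

noncomputable section

namespace CubicClifford

/-! ### Commutation rules -/

section Sequences

variable {R : Type*} [CommRing R]

/-- The coefficients `b i` of the rule `δ x ^ i = ω ^ (2i) x ^ i δ + b i α x ^ (i - 1)`, that is,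
the sum `1 + ω² + ⋯ + ω ^ (2(i - 1))`, in terms of `w = ω`. They vanish at `i = 0`, so that the
truncated exponent does no harm there. -/
def bCoeff (w : R) : ℕ → R
  | 0 => 0
  | i + 1 => w ^ 2 * bCoeff w i + 1

/-- The coefficients `c i` of the rule
`y x ^ i = ω ^ i x ^ i y + c i x ^ (i - 1) δ + d i α x ^ (i - 2)`. -/
def cCoeff (w : R) : ℕ → R
  | 0 => 0
  | i + 1 => w * cCoeff w i + (w ^ 2) ^ i

/-- The coefficients `d i` of the rule for `y x ^ i` in `cCoeff`; they vanish for `i ≤ 1`. -/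
def dCoeff (w : R) : ℕ → R
  | 0 => 0
  | i + 1 => w * dCoeff w i + bCoeff w i

@[simp] lemma bCoeff_zero (w : R) : bCoeff w 0 = 0 := rfl
@[simp] lemma cCoeff_zero (w : R) : cCoeff w 0 = 0 := rfl
@[simp] lemma dCoeff_zero (w : R) : dCoeff w 0 = 0 := rfl
lemma bCoeff_succ (w : R) (i : ℕ) : bCoeff w (i + 1) = w ^ 2 * bCoeff w i + 1 := rfl
lemma cCoeff_succ (w : R) (i : ℕ) : cCoeff w (i + 1) = w * cCoeff w i + (w ^ 2) ^ i := rfl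
lemma dCoeff_succ (w : R) (i : ℕ) : dCoeff w (i + 1) = w * dCoeff w i + bCoeff w i := rfl

/-- The coefficients are periodic with period `3` when `w` is a primitive third root of unity. -/
lemma coeff_cases {w : R} (hw : 1 + w + w ^ 2 = 0) (i : ℕ) :
    (w ^ i = 1 ∧ bCoeff w i = 0 ∧ cCoeff w i = 0 ∧ dCoeff w i = 0) ∨
    (w ^ i = w ∧ bCoeff w i = 1 ∧ cCoeff w i = 1 ∧ dCoeff w i = 0) ∨
    (w ^ i = w ^ 2 ∧ bCoeff w i = -w ∧ cCoeff w i = -1 ∧ dCoeff w i = 1) := by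
  have h3 : w ^ 3 = 1 := by linear_combination (w - 1) * hw
  induction i with
  | zero => simp
  | succ i ih =>
    rw [bCoeff_succ, cCoeff_succ, dCoeff_succ, pow_succ, ← pow_mul, mul_comm 2 i, pow_mul]
    rcases ih with ⟨h₁, h₂, h₃, h₄⟩ | ⟨h₁, h₂, h₃, h₄⟩ | ⟨h₁, h₂, h₃, h₄⟩ <;>
      rw [h₁, h₂, h₃, h₄]
    · right; left; simp
    · right; right
      refine ⟨by ring, by linear_combination hw, by linear_combination hw, by ring⟩
    · left
      refine ⟨by linear_combination h3, by linear_combination -h3,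
        by linear_combination w * h3, by ring⟩

end Sequences

variable {k : Type u} [Field k]

/-- The polynomial ring `k[α, β]`, with `α = X 0` and `β = X 1`, over which `A` is an
algebra. -/
abbrev CoeffRing (k : Type u) [Field k] : Type u := MvPolynomial (Fin 2) k

lemma x_cube_comm : x k ^ 3 * y k = y k * x k ^ 3 := by
  simpa [x, y] using RingQuot.mkAlgHom_rel k (Rel.cube_left (k := k))

lemma y_cube_comm : x k * y k ^ 3 = y k ^ 3 * x k := by
  simpa [x, y] using RingQuot.mkAlgHom_rel k (Rel.cube_right (k := k))

lemma square_rel : x k ^ 2 * y k ^ 2 + (x k * y k) ^ 2 = y k ^ 2 * x k ^ 2 + (y k * x k) ^ 2 := by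
  simpa [x, y] using RingQuot.mkAlgHom_rel k (Rel.square (k := k))

lemma adjoin_x_y : Algebra.adjoin k {x k, y k} = ⊤ := by
  have h : (Set.range (FreeAlgebra.ι k : Fin 2 → _)).image (RingQuot.mkAlgHom k (Rel k))
      = {x k, y k} := by
    rw [← Set.range_comp]
    ext a
    simp [Fin.exists_fin_two, x, y, eq_comm]
  rw [← h, ← AlgHom.map_adjoin, FreeAlgebra.adjoin_range_ι, Algebra.map_top,
    AlgHom.range_eq_top]
  exact RingQuot.mkAlgHom_surjective k (Rel k)

lemma mem_center_iff {z : A k} :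
    z ∈ Subalgebra.center k (A k) ↔ x k * z = z * x k ∧ y k * z = z * y k := by
  refine ⟨fun h ↦ ⟨Subalgebra.mem_center_iff.1 h _, Subalgebra.mem_center_iff.1 h _⟩,
    fun h ↦ Subalgebra.mem_center_iff.2 fun a ↦ ?_⟩
  have : Algebra.adjoin k {x k, y k} ≤ Subalgebra.centralizer k {z} := by
    rw [Algebra.adjoin_le_iff]
    rintro _ (rfl | rfl)
    · exact (Subalgebra.mem_centralizer_iff k).2 (by simpa using h.1.symm)
    · exact (Subalgebra.mem_centralizer_iff k).2 (by simpa using h.2.symm)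
  rw [adjoin_x_y] at this
  exact (Subalgebra.mem_centralizer_iff k |>.1 (this (Algebra.mem_top (x := a))) z rfl).symm

/-- The commutators of `α` with `x` and `y` are the relations `x³y = yx³` and
`x²y² + (xy)² = y²x² + (yx)²`. -/
lemma α_mem_center : α k ∈ Subalgebra.center k (A k) := by
  have h1 := sub_eq_zero.2 (x_cube_comm (k := k))
  have h2 := sub_eq_zero.2 (square_rel (k := k))
  rw [mem_center_iff, α, ← sub_eq_zero, ← sub_eq_zero (a := y k * _)]
  constructor
  · rw [← h1]; noncomm_ring
  · rw [← neg_eq_zero, ← h2]; noncomm_ring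

lemma β_mem_center : β k ∈ Subalgebra.center k (A k) := by
  have h1 := sub_eq_zero.2 (y_cube_comm (k := k))
  have h2 := sub_eq_zero.2 (square_rel (k := k))
  rw [mem_center_iff, β, ← sub_eq_zero, ← sub_eq_zero (a := y k * _)]
  constructor
  · rw [← h2]; noncomm_ring
  · rw [← neg_eq_zero, ← h1]; noncomm_ring

/-- The homomorphism from `k[α, β]` to the center of `A`. -/
def coeffHom (k : Type u) [Field k] : CoeffRing k →ₐ[k] Subalgebra.center k (A k) :=
  MvPolynomial.aeval ![⟨α k, α_mem_center⟩, ⟨β k, β_mem_center⟩]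

instance : Algebra (CoeffRing k) (A k) :=
  RingHom.toAlgebra' ((Subalgebra.center k (A k)).val.comp (coeffHom k)).toRingHom
    fun c a ↦ (Subalgebra.mem_center_iff.1 (coeffHom k c).2 a).symm

lemma algebraMap_coeffRing (c : CoeffRing k) :
    algebraMap (CoeffRing k) (A k) c = (coeffHom k c : A k) := rfl

instance : IsScalarTower k (CoeffRing k) (A k) :=
  .of_algebraMap_eq fun r ↦ by
    rw [algebraMap_coeffRing, AlgHom.commutes, Subalgebra.coe_algebraMap]

lemma X_zero_smul (a : A k) : (MvPolynomial.X 0 : CoeffRing k) • a = α k * a := by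
  simp [Algebra.smul_def, algebraMap_coeffRing, coeffHom]

lemma X_one_smul (a : A k) : (MvPolynomial.X 1 : CoeffRing k) • a = β k * a := by
  simp [Algebra.smul_def, algebraMap_coeffRing, coeffHom]

lemma C_smul (r : k) (a : A k) : (MvPolynomial.C r : CoeffRing k) • a = r • a := by
  rw [← MvPolynomial.algebraMap_eq, algebraMap_smul]

section PBW

variable {ω : k}

local notation "w" => (MvPolynomial.C ω : CoeffRing k)
local notation "X₀" => (MvPolynomial.X 0 : CoeffRing k)
local notation "X₁" => (MvPolynomial.X 1 : CoeffRing k)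

lemma one_add_C (hω : 1 + ω + ω ^ 2 = 0) : 1 + w + w ^ 2 = 0 := by
  rw [← map_pow, ← map_one MvPolynomial.C, ← map_add, ← map_add, hω, map_zero]

variable (ω) in
lemma y_mul_x : y k * x k = w • (x k * y k) + δ ω := by
  rw [C_smul, δ]; module

lemma δ_mul_x (hω : 1 + ω + ω ^ 2 = 0) : δ ω * x k = w ^ 2 • (x k * δ ω) + X₀ • 1 := by
  rw [X_zero_smul, mul_one, ← map_pow, C_smul, δ, α]
  have h : ω ^ 3 = 1 := by linear_combination (ω - 1) * hω
  simp only [sub_mul, mul_sub, smul_mul_assoc, mul_smul_comm, smul_sub, pow_two (x k), mul_assoc]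
  linear_combination (norm := module) h • (x k * (x k * y k)) - hω • (x k * (y k * x k))

lemma y_mul_δ (hω : 1 + ω + ω ^ 2 = 0) : y k * δ ω = w ^ 2 • (δ ω * y k) + X₁ • 1 := by
  rw [X_one_smul, mul_one, ← map_pow, C_smul, δ, β]
  have h : ω ^ 3 = 1 := by linear_combination (ω - 1) * hω
  simp only [sub_mul, mul_sub, smul_mul_assoc, mul_smul_comm, smul_sub, pow_two (y k), mul_assoc]
  linear_combination (norm := module) h • (x k * (y k * y k)) - hω • (y k * (x k * y k))

lemma δ_mul_x_pow (hω : 1 + ω + ω ^ 2 = 0) (i : ℕ) :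
    δ ω * x k ^ i = (w ^ 2) ^ i • (x k ^ i * δ ω) + (bCoeff w i * X₀) • x k ^ (i - 1) := by
  induction i with
  | zero => simp
  | succ i ih =>
    have hi : (bCoeff w i * X₀) • (x k * x k ^ (i - 1)) = (bCoeff w i * X₀) • x k ^ i := by
      rcases i with _ | i
      · simp
      · rw [Nat.add_sub_cancel, ← pow_succ']
    rw [pow_succ', ← mul_assoc, δ_mul_x hω, add_mul, smul_mul_assoc, smul_mul_assoc, one_mul,
      mul_assoc, ih, mul_add, mul_smul_comm, mul_smul_comm, hi, Nat.add_sub_cancel, bCoeff_succ,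
      mul_assoc (x k)]
    module

lemma y_mul_x_pow (hω : 1 + ω + ω ^ 2 = 0) (i : ℕ) :
    y k * x k ^ i = w ^ i • (x k ^ i * y k) + cCoeff w i • (x k ^ (i - 1) * δ ω)
      + (dCoeff w i * X₀) • x k ^ (i - 2) := by
  induction i with
  | zero => simp
  | succ i ih =>
    have hc : cCoeff w i • (x k * (x k ^ (i - 1) * δ ω)) = cCoeff w i • (x k ^ i * δ ω) := by
      rcases i with _ | i
      · simp
      · rw [Nat.add_sub_cancel, ← mul_assoc, ← pow_succ']
    have hd : (dCoeff w i * X₀) • (x k * x k ^ (i - 2)) = (dCoeff w i * X₀) • x k ^ (i - 1) := by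
      rcases i with _ | _ | i
      · simp
      · simp [dCoeff_succ]
      · rw [← pow_succ']; rfl
    rw [pow_succ', ← mul_assoc, y_mul_x ω, add_mul, smul_mul_assoc, mul_assoc, ih, mul_add, mul_add,
      mul_smul_comm, mul_smul_comm, mul_smul_comm, hc, hd, δ_mul_x_pow hω, Nat.add_sub_cancel,
      show i + 1 - 2 = i - 1 by lia, cCoeff_succ, dCoeff_succ, mul_assoc (x k)]
    module

lemma y_pow_mul_δ (hω : 1 + ω + ω ^ 2 = 0) (j : ℕ) :
    y k ^ j * δ ω = (w ^ 2) ^ j • (δ ω * y k ^ j) + (bCoeff w j * X₁) • y k ^ (j - 1) := by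
  induction j with
  | zero => simp
  | succ i ih =>
    have hi : (bCoeff w i * X₁) • (y k ^ (i - 1) * y k) = (bCoeff w i * X₁) • y k ^ i := by
      rcases i with _ | i
      · simp
      · rw [Nat.add_sub_cancel, ← pow_succ]
    rw [pow_succ, mul_assoc, y_mul_δ hω, mul_add, mul_smul_comm, mul_smul_comm, mul_one,
      ← mul_assoc, ih, add_mul, smul_mul_assoc, smul_mul_assoc, hi, Nat.add_sub_cancel, bCoeff_succ,
      mul_assoc _ _ (y k)]
    module

lemma y_pow_mul_x (hω : 1 + ω + ω ^ 2 = 0) (l : ℕ) :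
    y k ^ l * x k = w ^ l • (x k * y k ^ l) + cCoeff w l • (δ ω * y k ^ (l - 1))
      + (dCoeff w l * X₁) • y k ^ (l - 2) := by
  induction l with
  | zero => simp
  | succ i ih =>
    have hc : cCoeff w i • (δ ω * y k ^ (i - 1) * y k) = cCoeff w i • (δ ω * y k ^ i) := by
      rcases i with _ | i
      · simp
      · rw [Nat.add_sub_cancel, mul_assoc, ← pow_succ]
    have hd : (dCoeff w i * X₁) • (y k ^ (i - 2) * y k) = (dCoeff w i * X₁) • y k ^ (i - 1) := by
      rcases i with _ | _ | i
      · simp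
      · simp [dCoeff_succ]
      · rw [← pow_succ]; rfl
    rw [pow_succ, mul_assoc, y_mul_x ω, mul_add, mul_smul_comm, ← mul_assoc, ih, add_mul, add_mul,
      smul_mul_assoc, smul_mul_assoc, smul_mul_assoc, hc, hd, y_pow_mul_δ hω, Nat.add_sub_cancel,
      show i + 1 - 2 = i - 1 by lia, cCoeff_succ, dCoeff_succ, mul_assoc _ _ (y k)]
    module

lemma y_mul_δ_pow (hω : 1 + ω + ω ^ 2 = 0) (j : ℕ) :
    y k * δ ω ^ j = (w ^ 2) ^ j • (δ ω ^ j * y k) + (bCoeff w j * X₁) • δ ω ^ (j - 1) := by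
  induction j with
  | zero => simp
  | succ i ih =>
    have hi : (bCoeff w i * X₁) • (δ ω * δ ω ^ (i - 1)) = (bCoeff w i * X₁) • δ ω ^ i := by
      rcases i with _ | i
      · simp
      · rw [Nat.add_sub_cancel, ← pow_succ']
    rw [pow_succ', ← mul_assoc, y_mul_δ hω, add_mul, smul_mul_assoc, smul_mul_assoc, one_mul,
      mul_assoc, ih, mul_add, mul_smul_comm, mul_smul_comm, hi, Nat.add_sub_cancel, bCoeff_succ,
      mul_assoc (δ ω)]
    module

lemma δ_pow_mul_x (hω : 1 + ω + ω ^ 2 = 0) (j : ℕ) :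
    δ ω ^ j * x k = (w ^ 2) ^ j • (x k * δ ω ^ j) + (bCoeff w j * X₀) • δ ω ^ (j - 1) := by
  induction j with
  | zero => simp
  | succ i ih =>
    have hi : (bCoeff w i * X₀) • (δ ω ^ (i - 1) * δ ω) = (bCoeff w i * X₀) • δ ω ^ i := by
      rcases i with _ | i
      · simp
      · rw [Nat.add_sub_cancel, ← pow_succ]
    rw [pow_succ, mul_assoc, δ_mul_x hω, mul_add, mul_smul_comm, mul_smul_comm, mul_one,
      ← mul_assoc, ih, add_mul, smul_mul_assoc, smul_mul_assoc, hi, Nat.add_sub_cancel, bCoeff_succ,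
      mul_assoc _ _ (δ ω)]
    module

/-- The ordered monomial `x ^ i δ ^ j y ^ l`. -/
def mono (ω : k) (i j l : ℕ) : A k := x k ^ i * δ ω ^ j * y k ^ l

lemma mono_zero (ω : k) : mono ω 0 0 0 = 1 := by simp [mono]

lemma x_mul_mono (i j l : ℕ) : x k * mono ω i j l = mono ω (i + 1) j l := by
  simp only [mono, pow_succ', mul_assoc]

lemma mono_mul_y (i j l : ℕ) : mono ω i j l * y k = mono ω i j (l + 1) := by
  simp only [mono, pow_succ, mul_assoc]

/-- The action of `y` on ordered monomials. Exponents are truncated at zero, but then the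
coefficient in front of the monomial vanishes. -/
lemma y_mul_mono (hω : 1 + ω + ω ^ 2 = 0) (i j l : ℕ) :
    y k * mono ω i j l = (w ^ i * (w ^ 2) ^ j) • mono ω i j (l + 1)
      + (w ^ i * bCoeff w j * X₁) • mono ω i (j - 1) l
      + cCoeff w i • mono ω (i - 1) (j + 1) l + (dCoeff w i * X₀) • mono ω (i - 2) j l := by
  have h (a : A k) := congrArg (· * a) (y_mul_δ_pow hω j)
  simp only [add_mul, smul_mul_assoc, mul_assoc] at h
  simp only [mono, mul_assoc]
  rw [← mul_assoc, y_mul_x_pow hω]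
  simp only [add_mul, mul_add, smul_mul_assoc, mul_smul_comm, mul_assoc, h]
  simp only [pow_succ', mul_assoc, smul_add, smul_smul]

lemma mono_mul_x (hω : 1 + ω + ω ^ 2 = 0) (i j l : ℕ) :
    mono ω i j l * x k = (w ^ l * (w ^ 2) ^ j) • mono ω (i + 1) j l
      + (w ^ l * bCoeff w j * X₀) • mono ω i (j - 1) l
      + cCoeff w l • mono ω i (j + 1) (l - 1) + (dCoeff w l * X₁) • mono ω i j (l - 2) := by
  have h (a : A k) := congrArg (· * a) (δ_pow_mul_x hω j)
  simp only [add_mul, smul_mul_assoc, mul_assoc] at h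
  simp only [mono, mul_assoc]
  rw [y_pow_mul_x hω]
  simp only [mul_add, mul_smul_comm, h]
  rw [pow_succ (x k), pow_succ (δ ω)]
  simp only [mul_assoc, smul_add, smul_smul]

end PBW

/-! ### The basis of ordered monomials -/

section Relations

variable {R E : Type*} [CommRing R] [Ring E] [Algebra R E] {r : R} {a b d u v : E}

/-- Two of the rewriting rules recover `α = u²v + uvu + vu²`. -/
lemma cubic_relation_left (hr : 1 + r + r ^ 2 = 0) (h : v * u = r • (u * v) + d)
    (hd : d * u = r ^ 2 • (u * d) + a • 1) : u ^ 2 * v + u * v * u + v * u ^ 2 = a := by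
  have h3 : r ^ 3 = 1 := by linear_combination (r - 1) * hr
  obtain rfl : d = v * u - r • (u * v) := by rw [h]; abel
  simp only [sub_mul, mul_sub, smul_mul_assoc, mul_smul_comm, smul_sub, mul_assoc, smul_eq_mul,
    mul_one] at hd
  simp only [pow_two u, mul_assoc]
  linear_combination (norm := module) hd - h3 • (u * (u * v)) + hr • (u * (v * u))

/-- Two of the rewriting rules recover `β = uv² + vuv + v²u`. -/
lemma cubic_relation_right (hr : 1 + r + r ^ 2 = 0) (h : v * u = r • (u * v) + d)
    (hd : v * d = r ^ 2 • (d * v) + b • 1) : u * v ^ 2 + v * u * v + v ^ 2 * u = b := by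
  have h3 : r ^ 3 = 1 := by linear_combination (r - 1) * hr
  obtain rfl : d = v * u - r • (u * v) := by rw [h]; abel
  simp only [sub_mul, mul_sub, smul_mul_assoc, mul_smul_comm, smul_sub, mul_assoc, smul_eq_mul,
    mul_one] at hd
  simp only [pow_two v, mul_assoc]
  linear_combination (norm := module) hd - h3 • (u * (v * v)) + hr • (v * (u * v))

end Relations

variable {k : Type u} [Field k]

/-- The free module over `k[α, β]` on the symbols `x ^ i δ ^ j y ^ l`. -/
abbrev PBW (k : Type u) [Field k] : Type u := (ℕ × ℕ × ℕ) →₀ CoeffRing k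

/-- The basis vector for the monomial `x ^ i δ ^ j y ^ l`. -/
def e (i j l : ℕ) : PBW k := Finsupp.single (i, j, l) 1

section Sequences

variable {R : Type*} [CommRing R] {r : R}

lemma sq_pow_mul_pow (hr : 1 + r + r ^ 2 = 0) (i : ℕ) : (r ^ 2) ^ i * r ^ i = 1 := by
  rw [← mul_pow, show r ^ 2 * r = 1 by linear_combination (r - 1) * hr, one_pow]

lemma cCoeff_mul_pow (r : R) (i : ℕ) :
    (r ^ 2) ^ i * cCoeff r i = r ^ 2 * (cCoeff r i * (r ^ 2) ^ (i - 1)) := by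
  rcases i with _ | i
  · simp
  · rw [Nat.add_sub_cancel]; ring

lemma bCoeff_mul_pow (hr : 1 + r + r ^ 2 = 0) (i : ℕ) :
    bCoeff r i * r ^ (i - 1) = r ^ 2 * (r ^ i * bCoeff r i) := by
  rcases i with _ | i
  · simp
  · rw [Nat.add_sub_cancel]
    linear_combination (-r ^ i * bCoeff r (i + 1)) * ((r - 1) * hr)

lemma dCoeff_mul_pow (hr : 1 + r + r ^ 2 = 0) (i : ℕ) :
    (r ^ 2) ^ i * dCoeff r i + bCoeff r i * cCoeff r (i - 1)
      = r ^ 2 * (cCoeff r i * bCoeff r (i - 1) + dCoeff r i * (r ^ 2) ^ (i - 2)) := by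
  rcases i with _ | _ | i
  · simp
  · simp [dCoeff_succ]
  simp only [show i + 1 + 1 - 1 = i + 1 by lia, show i + 1 + 1 - 2 = i by lia,
    bCoeff_succ, cCoeff_succ, dCoeff_succ, pow_succ (r ^ 2)]
  rw [← pow_mul, mul_comm 2 i, pow_mul]
  rcases coeff_cases hr i with ⟨h₁, h₂, h₃, h₄⟩ | ⟨h₁, h₂, h₃, h₄⟩ | ⟨h₁, h₂, h₃, h₄⟩ <;>
    rw [h₁, h₂, h₃, h₄] <;> grind

lemma bCoeff_mul_dCoeff (hr : 1 + r + r ^ 2 = 0) (i : ℕ) :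
    bCoeff r i * dCoeff r (i - 1) = r ^ 2 * (dCoeff r i * bCoeff r (i - 2)) := by
  rcases i with _ | _ | i
  · simp
  · simp [dCoeff_succ]
  simp only [show i + 1 + 1 - 1 = i + 1 by lia, show i + 1 + 1 - 2 = i by lia,
    bCoeff_succ, dCoeff_succ]
  rcases coeff_cases hr i with ⟨-, h₂, -, h₄⟩ | ⟨-, h₂, -, h₄⟩ | ⟨-, h₂, -, h₄⟩ <;>
    rw [h₂, h₄] <;> grind

end Sequences

section Operators

variable (ω : k)

local notation "w" => (MvPolynomial.C ω : CoeffRing k)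
local notation "X₀" => (MvPolynomial.X 0 : CoeffRing k)
local notation "X₁" => (MvPolynomial.X 1 : CoeffRing k)

variable (k) in
/-- Left multiplication by `x` in terms of ordered monomials. -/
def xOp : Module.End (CoeffRing k) (PBW k) :=
  Finsupp.linearCombination _ fun p ↦ e (p.1 + 1) p.2.1 p.2.2

/-- Left multiplication by `δ` in terms of ordered monomials. -/
def δOp : Module.End (CoeffRing k) (PBW k) :=
  Finsupp.linearCombination _ fun p ↦ (w ^ 2) ^ p.1 • e p.1 (p.2.1 + 1) p.2.2
      + (bCoeff w p.1 * X₀) • e (p.1 - 1) p.2.1 p.2.2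

/-- Left multiplication by `y` in terms of ordered monomials. -/
def yOp : Module.End (CoeffRing k) (PBW k) :=
  Finsupp.linearCombination _ fun p ↦
    (w ^ p.1 * (w ^ 2) ^ p.2.1) • e p.1 p.2.1 (p.2.2 + 1)
      + (w ^ p.1 * bCoeff w p.2.1 * X₁) • e p.1 (p.2.1 - 1) p.2.2
      + cCoeff w p.1 • e (p.1 - 1) (p.2.1 + 1) p.2.2
      + (dCoeff w p.1 * X₀) • e (p.1 - 2) p.2.1 p.2.2

lemma xOp_e (i j l : ℕ) : xOp k (e i j l) = e (i + 1) j l := by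
  simp [xOp, e]

lemma δOp_e (i j l : ℕ) : δOp ω (e i j l) = (w ^ 2) ^ i • e i (j + 1) l
      + (bCoeff w i * X₀) • e (i - 1) j l := by
  simp [δOp, e]

lemma yOp_e (i j l : ℕ) : yOp ω (e i j l) = (w ^ i * (w ^ 2) ^ j) • e i j (l + 1)
      + (w ^ i * bCoeff w j * X₁) • e i (j - 1) l
      + cCoeff w i • e (i - 1) (j + 1) l + (dCoeff w i * X₀) • e (i - 2) j l := by
  simp [yOp, e]

lemma PBW.hom_ext {N : Type*} [AddCommMonoid N] [Module (CoeffRing k) N]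
    {f g : PBW k →ₗ[CoeffRing k] N} (h : ∀ i j l, f (e i j l) = g (e i j l)) : f = g :=
  Finsupp.lhom_ext' fun _ ↦ LinearMap.ext_ring (h _ _ _)

variable {ω}

lemma yOp_mul_xOp : yOp ω * xOp k = w • (xOp k * yOp ω) + δOp ω := by
  refine PBW.hom_ext fun i j l ↦ ?_
  simp only [Module.End.mul_apply, LinearMap.add_apply, LinearMap.smul_apply, xOp_e, yOp_e, δOp_e,
    map_add, map_smul, cCoeff_succ, dCoeff_succ, Nat.add_sub_cancel]
  rcases i with _ | _ | i
  · simp; module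
  · simp [cCoeff_succ, dCoeff_succ]; module
  · simp only [show i + 1 + 1 - 2 = i by lia, show i + 1 + 1 + 1 - 2 = i + 1 by lia,
      show i + 1 + 1 - 1 = i + 1 by lia]
    module

lemma δOp_mul_xOp : δOp ω * xOp k = w ^ 2 • (xOp k * δOp ω) + X₀ • 1 := by
  refine PBW.hom_ext fun i j l ↦ ?_
  simp only [Module.End.mul_apply, LinearMap.add_apply, LinearMap.smul_apply, xOp_e, δOp_e,
    map_add, map_smul, bCoeff_succ, Nat.add_sub_cancel, Module.End.one_apply]
  rcases i with _ | i
  · simp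
  · simp only [Nat.add_sub_cancel]
    module

lemma yOp_mul_δOp (hω : 1 + ω + ω ^ 2 = 0) :
    yOp ω * δOp ω = w ^ 2 • (δOp ω * yOp ω) + X₁ • 1 := by
  have hw := one_add_C hω
  refine PBW.hom_ext fun i j l ↦ ?_
  have hj : (bCoeff w j * X₁) • e i (j - 1 + 1) l = (bCoeff w j * X₁) • (e i j l : PBW k) := by
    rcases j with _ | j
    · simp
    · rfl
  simp only [Module.End.mul_apply, LinearMap.add_apply, LinearMap.smul_apply, yOp_e, δOp_e,
    map_add, map_smul, Nat.add_sub_cancel, Module.End.one_apply, bCoeff_succ _ j, Nat.sub_sub,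
    Nat.reduceAdd]
  -- One identity between the coefficient sequences for each basis vector that occurs.
  linear_combination (norm := module) (-(w ^ 2 * w ^ i * (w ^ 2) ^ i)) • hj
    + X₁ • sq_pow_mul_pow hw i • e i j l + cCoeff_mul_pow w i • e (i - 1) (j + 1 + 1) l
    + (X₀ * (w ^ 2) ^ j) • bCoeff_mul_pow hw i • e (i - 1) j (l + 1)
    + (X₀ * X₁ * bCoeff w j) • bCoeff_mul_pow hw i • e (i - 1) (j - 1) l
    + X₀ • dCoeff_mul_pow hw i • e (i - 2) (j + 1) l
    + X₀ ^ 2 • bCoeff_mul_dCoeff hw i • e (i - 3) j l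

lemma algebraMap_C (r : k) : algebraMap k (CoeffRing k) r = MvPolynomial.C r := rfl

lemma ops_α (hω : 1 + ω + ω ^ 2 = 0) :
    xOp k ^ 2 * yOp ω + xOp k * yOp ω * xOp k + yOp ω * xOp k ^ 2
      = algebraMap (CoeffRing k) _ X₀ := by
  rw [Algebra.algebraMap_eq_smul_one]
  exact cubic_relation_left (E := Module.End (CoeffRing k) (PBW k)) (one_add_C hω) yOp_mul_xOp
    δOp_mul_xOp

lemma ops_β (hω : 1 + ω + ω ^ 2 = 0) :
    xOp k * yOp ω ^ 2 + yOp ω * xOp k * yOp ω + yOp ω ^ 2 * xOp k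
      = algebraMap (CoeffRing k) _ X₁ := by
  rw [Algebra.algebraMap_eq_smul_one]
  exact cubic_relation_right (E := Module.End (CoeffRing k) (PBW k)) (one_add_C hω) yOp_mul_xOp
    (yOp_mul_δOp hω)

/-- The representation of `A` on the free module in which `x` and `y` act by `xOp` and `yOp`. The
relations of `A` express that the operators `α` and `β` are scalars, hence commute with these. -/
def rep (hω : 1 + ω + ω ^ 2 = 0) : A k →ₐ[k] Module.End (CoeffRing k) (PBW k) :=
  RingQuot.liftAlgHom k ⟨FreeAlgebra.lift k ![xOp k, yOp ω], by
    have hα := ops_α hω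
    have hβ := ops_β hω
    have h1 := Algebra.commutes X₀ (xOp k)
    have h2 := Algebra.commutes X₀ (yOp ω)
    have h3 := Algebra.commutes X₁ (yOp ω)
    rw [← hα, ← sub_eq_zero] at h1 h2
    rw [← hβ, ← sub_eq_zero] at h3
    rintro _ _ (_ | _ | _)
    · simp only [map_mul, map_pow, FreeAlgebra.lift_ι_apply, Matrix.cons_val_zero,
        Matrix.cons_val_one, ← sub_eq_zero (b := yOp ω * _)]
      rw [← neg_eq_zero, ← h1]
      noncomm_ring
    · simp only [map_mul, map_pow, FreeAlgebra.lift_ι_apply, Matrix.cons_val_zero,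
        Matrix.cons_val_one, ← sub_eq_zero (b := yOp ω ^ 3 * _)]
      rw [← h3]
      noncomm_ring
    · simp only [map_mul, map_pow, map_add, FreeAlgebra.lift_ι_apply, Matrix.cons_val_zero,
        Matrix.cons_val_one, ← sub_eq_zero (b := _ + (yOp ω * _) ^ 2)]
      rw [← h2]
      noncomm_ring⟩

variable (hω : 1 + ω + ω ^ 2 = 0)

@[simp] lemma rep_x : rep hω (x k) = xOp k := by
  simp [rep, x]

@[simp] lemma rep_y : rep hω (y k) = yOp ω := by
  simp [rep, y]

lemma rep_δ : rep hω (δ ω) = δOp ω := by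
  rw [δ, map_sub, map_smul, map_mul, map_mul, rep_x, rep_y, yOp_mul_xOp]
  refine LinearMap.ext fun m ↦ ?_
  simp only [LinearMap.sub_apply, LinearMap.add_apply, LinearMap.smul_apply]
  rw [← algebraMap_C, algebraMap_smul]
  abel

lemma rep_algebraMap (c : CoeffRing k) : rep hω (algebraMap _ _ c) = algebraMap _ _ c := by
  suffices h : (rep hω).comp (IsScalarTower.toAlgHom k (CoeffRing k) (A k))
      = IsScalarTower.toAlgHom k (CoeffRing k) _ from DFunLike.congr_fun h c
  refine MvPolynomial.algHom_ext fun i ↦ ?_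
  fin_cases i
  · simp [Algebra.algebraMap_eq_smul_one (A := A k), X_zero_smul, α, ops_α hω]
  · simp [Algebra.algebraMap_eq_smul_one (A := A k), X_one_smul, β, ops_β hω]

/-- The map `a ↦ a • 1`, which reads off the coefficients of `a` in the ordered monomials. -/
def evalOne : A k →ₗ[CoeffRing k] PBW k where
  toFun a := rep hω a (e 0 0 0)
  map_add' a b := by simp
  map_smul' c a := by simp [Algebra.smul_def, rep_algebraMap]

variable (ω) in
/-- The combination of ordered monomials in `A` with given coefficients. -/
def toA : PBW k →ₗ[CoeffRing k] A k :=
  Finsupp.linearCombination _ fun p ↦ mono ω p.1 p.2.1 p.2.2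

@[simp] lemma toA_e (i j l : ℕ) : toA ω (e i j l) = mono ω i j l := by
  simp [toA, e]

/-- The map `toA` is `A`-linear; in particular the ordered monomials span `A`. -/
lemma toA_rep (a : A k) (m : PBW k) : toA ω (rep hω a m) = a * toA ω m := by
  have ha : a ∈ Algebra.adjoin k {x k, y k} := by rw [adjoin_x_y]; exact Algebra.mem_top
  induction ha using Algebra.adjoin_induction generalizing m with
  | mem a ha =>
    obtain rfl | rfl := ha
    · suffices h : toA ω ∘ₗ xOp k = LinearMap.mulLeft _ (x k) ∘ₗ toA ω by
        simpa using DFunLike.congr_fun h m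
      exact PBW.hom_ext fun i j l ↦ by simp [xOp_e, x_mul_mono]
    · suffices h : toA ω ∘ₗ yOp ω = LinearMap.mulLeft _ (y k) ∘ₗ toA ω by
        simpa using DFunLike.congr_fun h m
      exact PBW.hom_ext fun i j l ↦ by simp [yOp_e, y_mul_mono hω]
  | algebraMap r => simp [Algebra.algebraMap_eq_smul_one, LinearMap.map_smul_of_tower]
  | add a b _ _ ha hb => simp [ha, hb, add_mul]
  | mul a b _ _ ha hb => simp [ha, hb, mul_assoc]

lemma rep_x_pow (i j l : ℕ) : rep hω (x k ^ i) (e 0 j l) = e i j l := by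
  induction i with
  | zero => simp
  | succ i ih => rw [pow_succ', map_mul, Module.End.mul_apply, ih, rep_x, xOp_e]

lemma rep_δ_pow (j l : ℕ) : rep hω (δ ω ^ j) (e 0 0 l) = e 0 j l := by
  induction j with
  | zero => simp
  | succ i ih => rw [pow_succ', map_mul, Module.End.mul_apply, ih, rep_δ, δOp_e]; simp

lemma rep_y_pow (l : ℕ) : rep hω (y k ^ l) (e 0 0 0) = e 0 0 l := by
  induction l with
  | zero => simp
  | succ i ih => rw [pow_succ', map_mul, Module.End.mul_apply, ih, rep_y, yOp_e]; simp

/-- The ordered monomials `x ^ i δ ^ j y ^ l` are a basis of `A` over `k[α, β]`. -/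
def pbwEquiv : PBW k ≃ₗ[CoeffRing k] A k :=
  .ofLinearMap (toA ω) (evalOne hω)
    (LinearMap.ext fun a ↦ by
      rw [LinearMap.comp_apply]
      exact (toA_rep hω a _).trans (by simp [mono_zero]))
    (PBW.hom_ext fun i j l ↦ by
      simp [evalOne, mono, -map_pow, rep_y_pow, rep_δ_pow, rep_x_pow])

lemma pbwEquiv_apply (m : PBW k) : pbwEquiv hω m = toA ω m := rfl

lemma pbwEquiv_symm_mono (i j l : ℕ) : (pbwEquiv hω).symm (mono ω i j l) = e i j l := by
  rw [LinearEquiv.symm_apply_eq, pbwEquiv_apply, toA_e]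

end Operators

variable {k : Type u} [Field k] {ω : k}

/-! ### The central elements and the Weierstrass equation -/

section Central

local notation "w" => (MvPolynomial.C ω : CoeffRing k)
local notation "X₀" => (MvPolynomial.X 0 : CoeffRing k)
local notation "X₁" => (MvPolynomial.X 1 : CoeffRing k)

lemma γ_eq (hω : 1 + ω + ω ^ 2 = 0) :
    γ k = mono ω 0 2 0 + (1 - w) • mono ω 1 1 1 + (w * X₀) • mono ω 0 0 1
      + (w * X₁) • mono ω 1 0 0 := by
  have hw := one_add_C hω
  have h1 : (x k * y k) ^ 2 = x k * (y k * (x k * (y k * mono ω 0 0 0))) := by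
    simp [mono_zero, pow_two, mul_assoc]
  have h2 : y k ^ 2 * x k ^ 2 = y k * (y k * (x k * (x k * mono ω 0 0 0))) := by
    simp [mono_zero, pow_two, mul_assoc]
  rw [γ, h1, h2]
  simp only [x_mul_mono, y_mul_mono hω, mul_add, mul_smul_comm, bCoeff, cCoeff, dCoeff]
  simp
  match_scalars
  all_goals grind

lemma γ_mem_center (hω : 1 + ω + ω ^ 2 = 0) : γ k ∈ Subalgebra.center k (A k) := by
  have hw := one_add_C hω
  rw [mem_center_iff, γ_eq hω]
  constructor
  · simp only [x_mul_mono, mono_mul_x hω, mul_add, add_mul, smul_mul_assoc, mul_smul_comm,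
      bCoeff, cCoeff, dCoeff]
    simp
    match_scalars
    all_goals grind
  · simp only [mono_mul_y, y_mul_mono hω, mul_add, add_mul, smul_mul_assoc, mul_smul_comm,
      bCoeff, cCoeff, dCoeff]
    simp
    match_scalars
    all_goals grind

lemma δ_cube_mem_center (hω : 1 + ω + ω ^ 2 = 0) : δ ω ^ 3 ∈ Subalgebra.center k (A k) := by
  have hw := one_add_C hω
  have h : bCoeff w 3 = 0 := by simp [bCoeff]; linear_combination (w ^ 2 - w + 1) * hw
  have h' : (w ^ 2) ^ 3 = 1 := by linear_combination (w ^ 3 + 1) * ((w - 1) * hw)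
  rw [mem_center_iff]
  constructor
  · rw [δ_pow_mul_x hω, h, h']; simp
  · rw [y_mul_δ_pow hω, h, h']; simp

lemma x_cube_mem_center : x k ^ 3 ∈ Subalgebra.center k (A k) :=
  mem_center_iff.2 ⟨by rw [← pow_succ', pow_succ], x_cube_comm.symm⟩

lemma y_cube_mem_center : y k ^ 3 ∈ Subalgebra.center k (A k) :=
  mem_center_iff.2 ⟨y_cube_comm, by rw [← pow_succ', pow_succ]⟩

lemma mul_mono_of_mem_center {z : A k} (hz : z ∈ Subalgebra.center k (A k)) (i j l : ℕ) :
    z * mono ω i j l = x k ^ i * δ ω ^ j * z * y k ^ l := by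
  rw [mono, ← mul_assoc, ← Subalgebra.mem_center_iff.1 hz (x k ^ i * δ ω ^ j)]

lemma x_cube_mul_mono (i j l : ℕ) : x k ^ 3 * mono ω i j l = mono ω (i + 3) j l := by
  rw [mono, mono, add_comm, pow_add]; simp only [mul_assoc]

lemma δ_cube_mul_mono (hω : 1 + ω + ω ^ 2 = 0) (i j l : ℕ) :
    δ ω ^ 3 * mono ω i j l = mono ω i (j + 3) l := by
  rw [mul_mono_of_mem_center (δ_cube_mem_center hω), mono, pow_add, mul_assoc (x k ^ i)]

lemma y_cube_mul_mono (i j l : ℕ) : y k ^ 3 * mono ω i j l = mono ω i j (l + 3) := by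
  rw [mul_mono_of_mem_center y_cube_mem_center, mono, add_comm, pow_add, mul_assoc _ (y k ^ 3)]

lemma γ_mul_mono (hω : 1 + ω + ω ^ 2 = 0) (i j l : ℕ) :
    γ k * mono ω i j l = mono ω i (j + 2) l
      + ((1 - w) * (w ^ 2) ^ j) • mono ω (i + 1) (j + 1) (l + 1)
      + (((1 - w) * bCoeff w j + w) * X₀) • mono ω i j (l + 1)
      + (w * (w ^ 2) ^ j * X₁) • mono ω (i + 1) j l
      + (w * bCoeff w j * X₀ * X₁) • mono ω i (j - 1) l := by
  have h (a : A k) := congrArg (· * a) (δ_pow_mul_x hω j)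
  have hj (a : A k) : (bCoeff w j * X₀) • (δ ω ^ (j - 1) * (δ ω * a))
      = (bCoeff w j * X₀) • (δ ω ^ j * a) := by
    rcases j with _ | j
    · simp
    · rw [Nat.add_sub_cancel, pow_succ, mul_assoc]
  simp only [add_mul, smul_mul_assoc, mul_assoc] at h
  rw [mul_mono_of_mem_center (γ_mem_center hω), γ_eq hω]
  simp only [mono, pow_zero, one_mul, mul_one, pow_one, mul_add, add_mul, smul_mul_assoc,
    mul_smul_comm, mul_assoc, h, hj]
  simp only [← mul_assoc, ← pow_succ, ← pow_succ', ← pow_add]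
  simp only [mul_assoc]
  module

lemma s_eq (ω : k) : s ω = mono ω 0 3 0
      - (MvPolynomial.C 2⁻¹ * (3 * MvPolynomial.C ω * (1 - MvPolynomial.C ω)) : CoeffRing k)
        • mono ω 3 0 3
      - (MvPolynomial.C 2⁻¹ * (1 + 2 * MvPolynomial.C ω ^ 2) * (X₀ * X₁)) • mono ω 0 0 0 := by
  have h3 : (3 : CoeffRing k) = MvPolynomial.C 3 := rfl
  have h2 : (2 : CoeffRing k) = MvPolynomial.C 2 := rfl
  have h : ((1 + 2 * ω ^ 2) • (α k * β k) : A k)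
      = (MvPolynomial.C (1 + 2 * ω ^ 2) * (X₀ * X₁) : CoeffRing k) • (1 : A k) := by
    rw [mul_smul, mul_smul, X_zero_smul, X_one_smul, mul_one, C_smul]
  rw [s, mono_zero, h, ← C_smul, ← C_smul, smul_add, smul_smul, smul_smul, sub_sub,
    ← mul_assoc (MvPolynomial.C 2⁻¹), h2, h3]
  simp [mono]

/-- The Weierstrass equation `s² = γ³ + Δ(x³, α, β, y³) / 4`, with `k[α, β]` acting by scalars. Both
sides are expanded by multiplying the unit repeatedly from the left, and compared on the ordered
monomials. -/
lemma s_sq (h2 : (2 : k) ≠ 0) (hω : 1 + ω + ω ^ 2 = 0) :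
    s ω ^ 2 = γ k ^ 3 + (MvPolynomial.C 4⁻¹ : CoeffRing k) •
      ((X₀ ^ 2 * X₁ ^ 2) • 1 - (4 * X₁ ^ 3) • x k ^ 3 - (4 * X₀ ^ 3) • y k ^ 3
        - (27 : CoeffRing k) • (x k ^ 3 * y k ^ 3) ^ 2
        + (18 * X₀ * X₁) • (x k ^ 3 * y k ^ 3)) := by
  have hw := one_add_C hω
  set c : CoeffRing k := MvPolynomial.C 2⁻¹ with hc
  have hc' : 2 * c = 1 := by
    rw [hc, show (2 : CoeffRing k) = MvPolynomial.C 2 from rfl, ← map_mul, mul_inv_cancel₀ h2,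
      map_one]
  have h4 : (MvPolynomial.C 4⁻¹ : CoeffRing k) = c ^ 2 := by
    rw [hc, ← map_pow]; congr 1; rw [inv_pow]; norm_num
  have hx : x k ^ 3 = mono ω 3 0 0 := by simp [mono]
  have hy : y k ^ 3 = mono ω 0 0 3 := by simp [mono]
  have h33 : x k ^ 3 * y k ^ 3 = mono ω 3 0 3 := by simp [mono]
  have hxy (i j l : ℕ) : mono ω 3 0 3 * mono ω i j l = mono ω (i + 3) j (l + 3) := by
    rw [← h33, mul_assoc, y_cube_mul_mono, x_cube_mul_mono]
  have hs (i j l : ℕ) : s ω * mono ω i j l = mono ω i (j + 3) l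
      - (c * (3 * w * (1 - w))) • mono ω (i + 3) j (l + 3)
      - (c * (1 + 2 * w ^ 2) * (X₀ * X₁)) • mono ω i j l := by
    rw [s_eq, sub_mul, sub_mul, smul_mul_assoc, smul_mul_assoc, hxy, mono_zero, one_mul,
      ← δ_cube_mul_mono hω i j l, hc]
    simp [mono]
  have hs2 : s ω ^ 2 = s ω * (s ω * mono ω 0 0 0) := by rw [mono_zero, mul_one, pow_two]
  have hγ : γ k ^ 3 = γ k * (γ k * (γ k * mono ω 0 0 0)) := by
    rw [mono_zero, mul_one, pow_succ', pow_two]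
  rw [h33, hx, hy, pow_two (mono ω 3 0 3), hxy, hs2, hγ, h4, ← mono_zero ω]
  simp only [hs, γ_mul_mono hω, mul_add, mul_sub, mul_smul_comm, bCoeff, smul_add, smul_sub]
  simp only [bCoeff_zero, mul_zero, zero_add, add_zero, mul_one, Nat.reduceAdd, Nat.reduceSub,
    zero_mul, zero_smul, smul_zero, pow_zero]
  clear hs hs2 hγ hxy hx hy h33
  clear_value c
  generalize (MvPolynomial.C ω : CoeffRing k) = r at *
  match_scalars
  all_goals grind

end Central

variable {k : Type u} [Field k] {ω : k}

/-! ### Leading terms -/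

section Filtration

/-- The total degree `i + j + l` of the monomial `x ^ i δ ^ j y ^ l`. -/
def deg (p : ℕ × ℕ × ℕ) : ℕ := p.1 + p.2.1 + p.2.2

variable (k) in
/-- The combinations of ordered monomials of degree strictly less than `n`. -/
def fil (n : ℕ) : Submodule (CoeffRing k) (PBW k) := Finsupp.supported _ _ {p | deg p < n}

lemma e_mem_fil {i j l n : ℕ} (h : i + j + l < n) : (e i j l : PBW k) ∈ fil k n :=
  Finsupp.single_mem_supported _ _ h

lemma smul_e_mem_fil {i j l n : ℕ} {c : CoeffRing k} (h : c ≠ 0 → i + j + l < n) :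
    c • (e i j l : PBW k) ∈ fil k n := by
  rcases eq_or_ne c 0 with rfl | hc
  · simp
  · exact Submodule.smul_mem _ _ (e_mem_fil (h hc))

lemma apply_eq_zero_of_mem_fil {m : PBW k} {n : ℕ} (hm : m ∈ fil k n) {p : ℕ × ℕ × ℕ}
    (hp : n ≤ deg p) : m p = 0 := by
  by_contra h
  exact absurd ((Finsupp.mem_supported _ _).1 hm (Finsupp.mem_support_iff.2 h)) (not_lt.2 hp)

lemma fil_mono {a b : ℕ} (h : a ≤ b) : fil k a ≤ fil k b :=
  Finsupp.supported_mono fun _ hp ↦ lt_of_lt_of_le hp h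

lemma fil_le_of_e_mem {S : Submodule (CoeffRing k) (PBW k)} {n : ℕ}
    (h : ∀ i j l, i + j + l < n → e i j l ∈ S) : fil k n ≤ S := by
  rw [fil, Finsupp.supported_eq_span_single, Submodule.span_le]
  rintro _ ⟨⟨i, j, l⟩, hp, rfl⟩
  exact h i j l hp

/-- If `D` raises the degree by one and multiplies leading terms by `χ`, moving `p` to `σ p`, then
the leading coefficients of `D m` are those of `m` times `χ`. -/
lemma apply_top {D : Module.End (CoeffRing k) (PBW k)} {χ : ℕ × ℕ × ℕ → CoeffRing k}
    {σ : ℕ × ℕ × ℕ → ℕ × ℕ × ℕ} (hσ : σ.Injective) (hdeg : ∀ p, deg (σ p) = deg p + 1)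
    (hD : ∀ p, D (Finsupp.single p 1) - χ p • Finsupp.single (σ p) 1 ∈ fil k (deg p + 1))
    {m : PBW k} {p : ℕ × ℕ × ℕ} (hm : m ∈ fil k (deg p + 1)) : D m (σ p) = m p * χ p := by
  have hq (q : ℕ × ℕ × ℕ) (hq : deg q ≤ deg p) :
      D (Finsupp.single q 1) (σ p) = if q = p then χ p else 0 := by
    have h := apply_eq_zero_of_mem_fil (hD q) (p := σ p) (by rw [hdeg]; lia)
    rw [Finsupp.sub_apply, Finsupp.smul_apply, sub_eq_zero] at h
    rw [h]
    split_ifs with hqp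
    · subst hqp; simp
    · rw [Finsupp.single_eq_of_ne (fun h ↦ hqp (hσ h.symm)), smul_zero]
  have h : D m = m.sum fun q c ↦ c • D (Finsupp.single q 1) := by
    conv_lhs => rw [← Finsupp.sum_single m]
    rw [map_finsuppSum]
    refine Finsupp.sum_congr fun q _ ↦ ?_
    rw [← map_smul, Finsupp.smul_single_one]
  rw [h, Finsupp.sum_apply, Finsupp.sum, Finset.sum_eq_single p]
  · simp [hq p le_rfl]
  · intro q hqm hqp
    have : deg q < deg p + 1 := (Finsupp.mem_supported _ _).1 hm hqm
    rw [Finsupp.smul_apply, hq q (by lia), if_neg hqp, smul_zero]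
  · intro hp
    simp [Finsupp.notMem_support_iff.1 hp]

open scoped Classical in
/-- Vectors whose leading terms are nonzero multiples of distinct monomials are independent. -/
lemma linearIndependent_of_leading {ι : Type*} {v : ι → PBW k} {u : ι → CoeffRing k}
    {p : ι → ℕ × ℕ × ℕ} (hp : p.Injective) (hu : ∀ i, u i ≠ 0)
    (h : ∀ i, v i - u i • Finsupp.single (p i) 1 ∈ fil k (deg (p i))) :
    LinearIndependent (CoeffRing k) v := by
  rw [linearIndependent_iff]
  intro c hc
  by_contra hne
  obtain ⟨i, hi, hmax⟩ := c.support.exists_max_image (fun i ↦ deg (p i))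
    (Finsupp.support_nonempty_iff.2 hne)
  have hv (j : ι) (hj : j ∈ c.support) : v j (p i) = if j = i then u i else 0 := by
    have h' := apply_eq_zero_of_mem_fil (h j) (p := p i) (hmax j hj)
    rw [Finsupp.sub_apply, Finsupp.smul_apply, sub_eq_zero] at h'
    rw [h']
    split_ifs with hij
    · subst hij; simp
    · rw [Finsupp.single_eq_of_ne (fun h ↦ hij (hp h.symm)), smul_zero]
  have h0 := DFunLike.congr_fun hc (p i)
  rw [Finsupp.linearCombination_apply, Finsupp.sum_apply, Finsupp.sum, Finset.sum_eq_single i,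
    Finsupp.smul_apply, hv i hi, if_pos rfl, Finsupp.zero_apply, smul_eq_mul,
    mul_eq_zero] at h0
  · exact h0.elim (Finsupp.mem_support_iff.1 hi) (hu i)
  · intro j hj hji
    rw [Finsupp.smul_apply, hv j hj, if_neg hji, smul_zero]
  · exact fun h ↦ absurd hi h

end Filtration

/-! ### The center -/

section Center

local notation "w" => (MvPolynomial.C ω : CoeffRing k)
local notation "X₀" => (MvPolynomial.X 0 : CoeffRing k)
local notation "X₁" => (MvPolynomial.X 1 : CoeffRing k)

/-- The endomorphism of the free module that corresponds to `f` under `pbwEquiv`. -/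
def conj (hω : 1 + ω + ω ^ 2 = 0) (f : Module.End (CoeffRing k) (A k)) :
    Module.End (CoeffRing k) (PBW k) :=
  (pbwEquiv hω).symm.toLinearMap ∘ₗ f ∘ₗ (pbwEquiv hω).toLinearMap

lemma conj_apply (hω : 1 + ω + ω ^ 2 = 0) (f : Module.End (CoeffRing k) (A k)) (m : PBW k) :
    conj hω f m = (pbwEquiv hω).symm (f (toA ω m)) := rfl

lemma commutator_x_sub_mem_fil (hω : 1 + ω + ω ^ 2 = 0) (i j l : ℕ) :
    conj hω (LinearMap.mulRight _ (x k) - LinearMap.mulLeft _ (x k)) (e i j l)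
      - (w ^ l * (w ^ 2) ^ j - 1) • e (i + 1) j l ∈ fil k (i + j + l + 1) := by
  rw [conj_apply, LinearMap.sub_apply, LinearMap.mulRight_apply, LinearMap.mulLeft_apply, toA_e,
    mono_mul_x hω, x_mul_mono]
  simp only [map_add, map_sub, map_smul, pbwEquiv_symm_mono]
  have h1 : (w ^ l * bCoeff w j * X₀) • e i (j - 1) l ∈ fil k (i + j + l + 1) :=
    smul_e_mem_fil fun _ ↦ by lia
  have h2 : cCoeff w l • e i (j + 1) (l - 1) ∈ fil k (i + j + l + 1) := by
    refine smul_e_mem_fil fun h ↦ ?_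
    rcases l with _ | l
    · simp at h
    · lia
  have h3 : (dCoeff w l * X₁) • e i j (l - 2) ∈ fil k (i + j + l + 1) :=
    smul_e_mem_fil fun _ ↦ by lia
  convert add_mem (add_mem h1 h2) h3 using 1
  module

lemma commutator_y_sub_mem_fil (hω : 1 + ω + ω ^ 2 = 0) (i j l : ℕ) :
    conj hω (LinearMap.mulLeft _ (y k) - LinearMap.mulRight _ (y k)) (e i j l)
      - (w ^ i * (w ^ 2) ^ j - 1) • e i j (l + 1) ∈ fil k (i + j + l + 1) := by
  rw [conj_apply, LinearMap.sub_apply, LinearMap.mulRight_apply, LinearMap.mulLeft_apply, toA_e,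
    y_mul_mono hω, mono_mul_y]
  simp only [map_add, map_sub, map_smul, pbwEquiv_symm_mono]
  have h1 : (w ^ i * bCoeff w j * X₁) • e i (j - 1) l ∈ fil k (i + j + l + 1) :=
    smul_e_mem_fil fun _ ↦ by lia
  have h2 : cCoeff w i • e (i - 1) (j + 1) l ∈ fil k (i + j + l + 1) := by
    refine smul_e_mem_fil fun h ↦ ?_
    rcases i with _ | i
    · simp at h
    · lia
  have h3 : (dCoeff w i * X₀) • e (i - 2) j l ∈ fil k (i + j + l + 1) :=
    smul_e_mem_fil fun _ ↦ by lia
  convert add_mem (add_mem h1 h2) h3 using 1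
  module

lemma modEq_of_pow_mul_pow_eq_one (hω : IsPrimitiveRoot ω 3) {i j : ℕ}
    (h : w ^ i * (w ^ 2) ^ j - 1 = 0) : i ≡ j [MOD 3] := by
  rw [sub_eq_zero, ← pow_mul, ← pow_add, ← map_pow, ← map_one MvPolynomial.C,
    MvPolynomial.C_inj, hω.pow_eq_one_iff_dvd] at h
  rw [Nat.ModEq]
  lia

lemma one_add_add_sq (hω : IsPrimitiveRoot ω 3) : 1 + ω + ω ^ 2 = 0 := by
  have h := hω.geom_sum_eq_zero (by norm_num)
  simpa [Finset.sum_range_succ] using h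

/-- The exponents of the leading monomials of a central element are congruent modulo `3`. -/
lemma exponents_modEq (hω : IsPrimitiveRoot ω 3) {i j l : ℕ} {m : PBW k}
    (hm : m ∈ fil k (i + j + l + 1)) (hc : toA ω m ∈ Subalgebra.center k (A k))
    (h0 : m (i, j, l) ≠ 0) : i ≡ j [MOD 3] ∧ l ≡ j [MOD 3] := by
  have hω' := one_add_add_sq hω
  rw [mem_center_iff] at hc
  have h1 := apply_top (p := (i, j, l)) (σ := fun p ↦ (p.1 + 1, p.2.1, p.2.2))
    (χ := fun p ↦ w ^ p.2.2 * (w ^ 2) ^ p.2.1 - 1)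
    (by rintro ⟨a, b, c⟩ ⟨a', b', c'⟩ h; simpa using h) (fun p ↦ by simp only [deg]; lia)
    (fun p ↦ commutator_x_sub_mem_fil hω' p.1 p.2.1 p.2.2) hm
  have h2 := apply_top (p := (i, j, l)) (σ := fun p ↦ (p.1, p.2.1, p.2.2 + 1))
    (χ := fun p ↦ w ^ p.1 * (w ^ 2) ^ p.2.1 - 1)
    (by rintro ⟨a, b, c⟩ ⟨a', b', c'⟩ h; simpa using h) (fun p ↦ by simp only [deg]; lia)
    (fun p ↦ commutator_y_sub_mem_fil hω' p.1 p.2.1 p.2.2) hm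
  rw [conj_apply, LinearMap.sub_apply, LinearMap.mulRight_apply, LinearMap.mulLeft_apply, hc.1,
    sub_self, map_zero, Finsupp.zero_apply, eq_comm, mul_eq_zero, or_iff_right h0] at h1
  rw [conj_apply, LinearMap.sub_apply, LinearMap.mulRight_apply, LinearMap.mulLeft_apply, hc.2,
    sub_self, map_zero, Finsupp.zero_apply, eq_comm, mul_eq_zero, or_iff_right h0] at h2
  exact ⟨modEq_of_pow_mul_pow_eq_one hω h2, modEq_of_pow_mul_pow_eq_one hω h1⟩

/-- The element `a` equals `u x ^ i δ ^ j y ^ l` up to terms of smaller degree; `u = 0` is allowed.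
-/
def HasLeading (hω : 1 + ω + ω ^ 2 = 0) (a : A k) (i j l : ℕ) (u : k) : Prop :=
  (pbwEquiv hω).symm a - (MvPolynomial.C u : CoeffRing k) • e i j l ∈ fil k (i + j + l)

lemma hasLeading_mono (hω : 1 + ω + ω ^ 2 = 0) (i j l : ℕ) :
    HasLeading hω (mono ω i j l) i j l 1 := by
  simp [HasLeading, pbwEquiv_symm_mono]

lemma conj_γ_e (hω : 1 + ω + ω ^ 2 = 0) (i j l : ℕ) :
    conj hω (LinearMap.mulLeft _ (γ k)) (e i j l)
      - ((1 - w) * (w ^ 2) ^ j) • e (i + 1) (j + 1) (l + 1) ∈ fil k (i + j + l + 3) := by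
  rw [conj_apply, LinearMap.mulLeft_apply, toA_e, γ_mul_mono hω]
  simp only [map_add, map_smul, pbwEquiv_symm_mono]
  have h1 : e i (j + 2) l ∈ fil k (i + j + l + 3) := e_mem_fil (by lia)
  have h2 : (((1 - w) * bCoeff w j + w) * X₀) • e i j (l + 1) ∈ fil k (i + j + l + 3) :=
    smul_e_mem_fil fun _ ↦ by lia
  have h3 : (w * (w ^ 2) ^ j * X₁) • e (i + 1) j l ∈ fil k (i + j + l + 3) :=
    smul_e_mem_fil fun _ ↦ by lia
  have h4 : (w * bCoeff w j * X₀ * X₁) • e i (j - 1) l ∈ fil k (i + j + l + 3) :=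
    smul_e_mem_fil fun _ ↦ by lia
  convert add_mem (add_mem (add_mem h1 h2) h3) h4 using 1
  module

lemma conj_γ_mem_fil (hω : 1 + ω + ω ^ 2 = 0) {n : ℕ} {m : PBW k} (hm : m ∈ fil k n) :
    conj hω (LinearMap.mulLeft _ (γ k)) m ∈ fil k (n + 3) := by
  suffices h : fil k n ≤ (fil k (n + 3)).comap (conj hω (LinearMap.mulLeft _ (γ k))) from h hm
  refine fil_le_of_e_mem fun i j l h ↦ ?_
  have h' : ((1 - w) * (w ^ 2) ^ j) • e (i + 1) (j + 1) (l + 1) ∈ fil k (n + 3) :=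
    smul_e_mem_fil fun _ ↦ by lia
  simpa using add_mem (fil_mono (by lia) (conj_γ_e hω i j l)) h'

lemma HasLeading.γ_mul {hω : 1 + ω + ω ^ 2 = 0} {a : A k} {i j l : ℕ} {u : k}
    (h : HasLeading hω a i j l u) :
    HasLeading hω (γ k * a) (i + 1) (j + 1) (l + 1) (u * ((1 - ω) * (ω ^ 2) ^ j)) := by
  have h1 := conj_γ_mem_fil hω h
  have h2 := Submodule.smul_mem _ (MvPolynomial.C u) (conj_γ_e hω i j l)
  rw [map_sub, map_smul, conj_apply, ← pbwEquiv_apply hω, LinearEquiv.apply_symm_apply,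
    LinearMap.mulLeft_apply] at h1
  rw [HasLeading, show i + 1 + (j + 1) + (l + 1) = i + j + l + 3 by lia]
  convert add_mem h1 h2 using 1
  simp only [map_mul, map_sub, map_pow, map_one]
  module

lemma HasLeading.γ_pow_mul (hω : IsPrimitiveRoot ω 3) {a : A k} {i j l : ℕ} {u : k}
    (h : HasLeading (one_add_add_sq hω) a i j l u) (hu : u ≠ 0) (r : ℕ) :
    ∃ v ≠ 0, HasLeading (one_add_add_sq hω) (γ k ^ r * a) (i + r) (j + r) (l + r) v := by
  induction r with
  | zero => exact ⟨u, hu, by simpa⟩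
  | succ r ih =>
    obtain ⟨v, hv, h⟩ := ih
    have h1 : 1 - ω ≠ 0 := sub_ne_zero.2 (hω.ne_one (by norm_num)).symm
    refine ⟨_, ?_, by
      simpa only [pow_succ' (γ k) r, mul_assoc (γ k), ← add_assoc] using h.γ_mul⟩
    have h0 : ω ≠ 0 := hω.ne_zero (by norm_num)
    exact mul_ne_zero hv (mul_ne_zero h1 (pow_ne_zero _ (pow_ne_zero _ h0)))

variable (ω) in
/-- The subalgebra generated by `x³, y³, α, β, γ, δ³`. -/
def centerGen : Subalgebra k (A k) :=
  Algebra.adjoin k {x k ^ 3, y k ^ 3, α k, β k, γ k, δ ω ^ 3}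

lemma centerGen_le_center (hω : 1 + ω + ω ^ 2 = 0) :
    centerGen ω ≤ Subalgebra.center k (A k) := by
  rw [centerGen, Algebra.adjoin_le_iff]
  rintro _ (rfl | rfl | rfl | rfl | rfl | rfl)
  exacts [x_cube_mem_center, y_cube_mem_center, α_mem_center, β_mem_center, γ_mem_center hω,
    δ_cube_mem_center hω]

lemma x_cube_mem : x k ^ 3 ∈ centerGen ω := Algebra.subset_adjoin (by simp)
lemma y_cube_mem : y k ^ 3 ∈ centerGen ω := Algebra.subset_adjoin (by simp)
lemma γ_mem : γ k ∈ centerGen ω := Algebra.subset_adjoin (by simp)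
lemma δ_cube_mem : δ ω ^ 3 ∈ centerGen ω := Algebra.subset_adjoin (by simp)

lemma algebraMap_mem_centerGen (c : CoeffRing k) : algebraMap _ (A k) c ∈ centerGen ω := by
  induction c using MvPolynomial.induction_on with
  | C r =>
    rw [← MvPolynomial.algebraMap_eq, ← IsScalarTower.algebraMap_apply]
    exact Subalgebra.algebraMap_mem _ r
  | add p q hp hq => rw [map_add]; exact add_mem hp hq
  | mul_X p i hp =>
    rw [map_mul]
    refine mul_mem hp ?_
    rw [Algebra.algebraMap_eq_smul_one]
    fin_cases i
    · rw [Fin.zero_eta, X_zero_smul, mul_one]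
      exact Algebra.subset_adjoin (by simp)
    · rw [Fin.mk_one, X_one_smul, mul_one]
      exact Algebra.subset_adjoin (by simp)

variable (ω) in
/-- The subalgebra `centerGen`, as a module over `k[α, β]`, inside the free module on monomials. -/
def centerGenSubmodule : Submodule (CoeffRing k) (PBW k) :=
  Submodule.comap (toA ω)
    { (Subalgebra.toSubmodule (centerGen ω)).toAddSubmonoid with
      smul_mem' := fun c a ha ↦ by
        rw [Algebra.smul_def]
        exact mul_mem (algebraMap_mem_centerGen c) ha }

lemma mem_centerGenSubmodule {m : PBW k} : m ∈ centerGenSubmodule ω ↔ toA ω m ∈ centerGen ω :=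
  Iff.rfl

/-- A monomial whose exponents are congruent modulo `3` is the leading term of an element of
`centerGen`, up to a unit. -/
lemma e_mem_sup (hω : IsPrimitiveRoot ω 3) {i j l : ℕ} (h1 : i ≡ j [MOD 3]) (h2 : l ≡ j [MOD 3]) :
    e i j l ∈ centerGenSubmodule ω ⊔ fil k (i + j + l) := by
  -- The common remainder `r` is the exponent of `γ`, whose leading monomial is `xδy`.
  obtain ⟨r, i, j, l, rfl, rfl, rfl⟩ :
      ∃ r i' j' l', i = 3 * i' + r ∧ j = 3 * j' + r ∧ l = 3 * l' + r :=
    ⟨j % 3, i / 3, j / 3, l / 3, by rw [Nat.ModEq] at *; lia⟩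
  obtain ⟨v, hv, h⟩ := (hasLeading_mono (one_add_add_sq hω) (3 * i) (3 * j) (3 * l)).γ_pow_mul hω
    one_ne_zero r
  have hm : (pbwEquiv (one_add_add_sq hω)).symm (γ k ^ r * mono ω (3 * i) (3 * j) (3 * l))
      ∈ centerGenSubmodule ω := by
    rw [mem_centerGenSubmodule, ← pbwEquiv_apply (one_add_add_sq hω),
      LinearEquiv.apply_symm_apply, mono, pow_mul, pow_mul, pow_mul]
    exact mul_mem (pow_mem γ_mem _) (mul_mem (mul_mem (pow_mem x_cube_mem _)
      (pow_mem δ_cube_mem _)) (pow_mem y_cube_mem _))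
  have hs := Submodule.smul_mem _ (MvPolynomial.C v⁻¹) (sub_mem (Submodule.mem_sup_left hm)
    (Submodule.mem_sup_right (S := centerGenSubmodule ω) h))
  rwa [sub_sub_cancel, smul_smul, ← map_mul, inv_mul_cancel₀ hv, map_one, one_smul] at hs

lemma mem_centerGen_of_mem_fil (hω : IsPrimitiveRoot ω 3) (n : ℕ) {m : PBW k} (hm : m ∈ fil k n)
    (hc : toA ω m ∈ Subalgebra.center k (A k)) : toA ω m ∈ centerGen ω := by
  induction n generalizing m with
  | zero =>
    have : m = 0 := by
      ext1 p
      exact apply_eq_zero_of_mem_fil hm (Nat.zero_le _)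
    simp [this]
  | succ n ih =>
    have hs : m ∈ centerGenSubmodule ω ⊔ fil k n := by
      rw [← Finsupp.sum_single m]
      refine sum_mem fun ⟨i, j, l⟩ hp ↦ ?_
      rw [← Finsupp.smul_single_one]
      refine Submodule.smul_mem _ _ ?_
      have hd : i + j + l < n + 1 := (Finsupp.mem_supported _ _).1 hm hp
      rcases Nat.lt_succ_iff_lt_or_eq.1 hd with hd | rfl
      · exact Submodule.mem_sup_right (e_mem_fil hd)
      · have h := exponents_modEq hω hm hc (Finsupp.mem_support_iff.1 hp)
        exact e_mem_sup hω h.1 h.2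
    obtain ⟨a, ha, b, hb, rfl⟩ := Submodule.mem_sup.1 hs
    rw [mem_centerGenSubmodule] at ha
    rw [map_add] at hc ⊢
    refine add_mem ha (ih hb ?_)
    simpa using sub_mem hc (centerGen_le_center (one_add_add_sq hω) ha)

theorem center_eq_centerGen (hω : IsPrimitiveRoot ω 3) :
    Subalgebra.center k (A k) = centerGen ω := by
  refine le_antisymm (fun a ha ↦ ?_) (centerGen_le_center (one_add_add_sq hω))
  obtain ⟨m, rfl⟩ := (pbwEquiv (one_add_add_sq hω)).surjective a
  rw [pbwEquiv_apply] at ha ⊢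
  refine mem_centerGen_of_mem_fil hω (m.support.sup deg + 1) ?_ ha
  exact (Finsupp.mem_supported _ _).2 fun p hp ↦ Nat.lt_succ_of_le (Finset.le_sup (f := deg) hp)

/-- The leading monomial of `γ ^ r x ^ (3i) y ^ (3l)` has exponents `(3i + r, r, 3l + r)`, which
determine `r`, `i` and `l`. -/
lemma linearIndependent_γ_pow_mul_mono (hω : IsPrimitiveRoot ω 3) :
    LinearIndependent (CoeffRing k)
      fun p : ℕ × ℕ × ℕ ↦ γ k ^ p.1 * mono ω (3 * p.2.1) 0 (3 * p.2.2) := by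
  have h (p : ℕ × ℕ × ℕ) := (hasLeading_mono (one_add_add_sq hω) (3 * p.2.1) 0
    (3 * p.2.2)).γ_pow_mul hω one_ne_zero p.1
  choose v hv hl using h
  rw [← LinearMap.linearIndependent_iff (pbwEquiv (one_add_add_sq hω)).symm.toLinearMap
    (LinearEquiv.ker _)]
  refine linearIndependent_of_leading (u := fun p ↦ MvPolynomial.C (v p))
    (p := fun p ↦ (3 * p.2.1 + p.1, 0 + p.1, 3 * p.2.2 + p.1)) ?_ (fun p ↦ by simpa using hv p) hl
  rintro ⟨a, b, c⟩ ⟨a', b', c'⟩ h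
  simp only [Prod.mk.injEq] at h ⊢
  lia

end Center

/-! ### The coordinate ring of the curve and the center -/

section LinearAlgebra

lemma injective_of_linearIndependent_basis {R ι M N : Type*} [Ring R] [AddCommGroup M] [Module R M]
    [AddCommGroup N] [Module R N] (b : Module.Basis ι R M) (f : M →ₗ[R] N)
    (h : LinearIndependent R fun i ↦ f (b i)) : Function.Injective f := by
  have hf : f = Finsupp.linearCombination R (fun i ↦ f (b i)) ∘ₗ b.repr.toLinearMap :=
    b.ext fun i ↦ by simp
  rw [hf, LinearMap.coe_comp]
  exact (linearIndependent_iff_injective_finsuppLinearCombination.1 h).comp b.repr.injective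

/-- A homomorphism from a Weierstrass coordinate ring over a domain is injective if it is so on the
polynomial ring in the first coordinate: the norm of a kernel element is a multiple of the element,
hence lies in the kernel too. -/
lemma injective_of_injective_comp_algebraMap {R T : Type*} [CommRing R] [IsDomain R] [CommRing T]
    (W : WeierstrassCurve.Affine R) (f : W.CoordinateRing →+* T)
    (hf : Function.Injective (f.comp (algebraMap (Polynomial R) W.CoordinateRing))) :
    Function.Injective f := by
  refine (injective_iff_map_eq_zero f).2 fun a ha ↦ ?_
  have hdvd : a ∣ algebraMap _ _ (Algebra.norm (Polynomial R) a) := by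
    obtain ⟨p, q, rfl⟩ := WeierstrassCurve.Affine.CoordinateRing.exists_smul_basis_eq a
    have h := WeierstrassCurve.Affine.CoordinateRing.coe_norm_smul_basis (W' := W) p q
    refine ⟨_, (h.trans (map_mul _ _ _)).trans (congrArg (· * _) ?_)⟩
    rw [map_add, map_mul, WeierstrassCurve.Affine.CoordinateRing.smul,
      WeierstrassCurve.Affine.CoordinateRing.smul, mul_one]
  have h0 : Algebra.norm (Polynomial R) a = 0 := by
    refine (injective_iff_map_eq_zero _).1 hf _ ?_
    rw [RingHom.comp_apply]
    exact zero_dvd_iff.1 (ha ▸ map_dvd f hdvd)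
  have : Module.Finite (Polynomial R) W.CoordinateRing :=
    .of_basis (WeierstrassCurve.Affine.CoordinateRing.basis W)
  exact Algebra.norm_eq_zero_iff.1 h0

end LinearAlgebra

variable {k : Type u} [Field k] {ω : k}

section CurveLift

variable {T : Type*} [CommRing T] [Algebra k T]

/-- The value of `Δ / 4`, written with the same grouping of the terms as in `s_sq`. -/
lemma map_curve_a₆ (φ : FormRing k →ₐ[k] T) (ψ : CoeffRing k →ₐ[k] T)
    (h1 : φ (MvPolynomial.X 1) = ψ (MvPolynomial.X 0))
    (h2 : φ (MvPolynomial.X 2) = ψ (MvPolynomial.X 1)) :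
    φ (curve k).a₆ = ψ (MvPolynomial.C 4⁻¹) *
      (ψ (MvPolynomial.X 0 ^ 2 * MvPolynomial.X 1 ^ 2) * 1
        - ψ (4 * MvPolynomial.X 1 ^ 3) * φ (MvPolynomial.X 0)
        - ψ (4 * MvPolynomial.X 0 ^ 3) * φ (MvPolynomial.X 3)
        - ψ 27 * (φ (MvPolynomial.X 0) * φ (MvPolynomial.X 3)) ^ 2
        + ψ (18 * MvPolynomial.X 0 * MvPolynomial.X 1) *
          (φ (MvPolynomial.X 0) * φ (MvPolynomial.X 3))) := by
  simp only [curve, genericForm, Cubic.discr, map_mul, map_add, map_sub, map_pow, map_ofNat,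
    h1, h2, ← MvPolynomial.algebraMap_eq, AlgHom.commutes]
  ring

/-- The algebra homomorphism from `k[a, b, c, d][g]` that is `φ` on forms and sends the variable to
`g`. It is an algebra homomorphism over `k`, not over `k[a, b, c, d]`, which does not act on `T`. -/
def polyLift (φ : FormRing k →ₐ[k] T) (g : T) : Polynomial (FormRing k) →ₐ[k] T :=
  { Polynomial.eval₂RingHom φ.toRingHom g with
    commutes' := fun r ↦ by
      rw [IsScalarTower.algebraMap_apply k (FormRing k)]
      simp }

@[simp] lemma polyLift_C (φ : FormRing k →ₐ[k] T) (g : T) (c : FormRing k) :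
    polyLift φ g (Polynomial.C c) = φ c := by
  simp [polyLift]

@[simp] lemma polyLift_X (φ : FormRing k →ₐ[k] T) (g : T) : polyLift φ g Polynomial.X = g := by
  simp [polyLift]

lemma eval₂_curve_polynomial {φ : FormRing k →ₐ[k] T} {g t : T}
    (h : t ^ 2 = g ^ 3 + φ (curve k).a₆) :
    (curve k).polynomial.eval₂ (polyLift φ g : Polynomial (FormRing k) →+* T) t = 0 := by
  have h1 : (curve k).a₁ = 0 := rfl
  have h2 : (curve k).a₂ = 0 := rfl
  have h3 : (curve k).a₃ = 0 := rfl
  have h4 : (curve k).a₄ = 0 := rfl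
  rw [WeierstrassCurve.Affine.polynomial, h1, h2, h3, h4]
  simp only [map_zero, zero_mul, add_zero, Polynomial.eval₂_sub, Polynomial.eval₂_pow,
    Polynomial.eval₂_X, Polynomial.eval₂_C, RingHom.coe_coe]
  simp only [map_add, map_pow, polyLift_X, polyLift_C, h, sub_self]

/-- The homomorphism from the coordinate ring of the curve given by a solution `(g, t)` of its
equation over the base change along `φ`. -/
def curveLift (φ : FormRing k →ₐ[k] T) (g t : T) (h : t ^ 2 = g ^ 3 + φ (curve k).a₆) :
    (curve k).CoordinateRing →ₐ[k] T :=
  AdjoinRoot.liftAlgHom _ (polyLift φ g) t (eval₂_curve_polynomial h)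

lemma curveLift_mk {φ : FormRing k →ₐ[k] T} {g t : T} (h : t ^ 2 = g ^ 3 + φ (curve k).a₆)
    (p : Polynomial (Polynomial (FormRing k))) :
    curveLift φ g t h (WeierstrassCurve.Affine.CoordinateRing.mk (curve k) p)
      = p.eval₂ (polyLift φ g : Polynomial (FormRing k) →+* T) t := rfl

lemma curveLift_algebraMap {φ : FormRing k →ₐ[k] T} {g t : T}
    (h : t ^ 2 = g ^ 3 + φ (curve k).a₆) (c : FormRing k) :
    curveLift φ g t h (algebraMap _ _ c) = φ c := by
  refine (curveLift_mk h (Polynomial.C (Polynomial.C c))).trans ?_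
  simp

lemma curveLift_curveγ {φ : FormRing k →ₐ[k] T} {g t : T}
    (h : t ^ 2 = g ^ 3 + φ (curve k).a₆) : curveLift φ g t h (curveγ k) = g := by
  rw [curveγ, curveLift_mk]
  simp

lemma curveLift_curveS {φ : FormRing k →ₐ[k] T} {g t : T}
    (h : t ^ 2 = g ^ 3 + φ (curve k).a₆) : curveLift φ g t h (curveS k) = t := by
  rw [curveS, curveLift_mk]
  simp

lemma curveLift_injective {φ : FormRing k →ₐ[k] T} {g t : T}
    (h : t ^ 2 = g ^ 3 + φ (curve k).a₆) (hinj : Function.Injective (polyLift φ g)) :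
    Function.Injective (curveLift φ g t h) := by
  refine injective_of_injective_comp_algebraMap (curve k)
    (curveLift φ g t h : (curve k).CoordinateRing →+* T) ?_
  convert hinj using 1
  ext1 p
  exact (curveLift_mk h (Polynomial.C p)).trans (Polynomial.eval₂_C _ _)

end CurveLift

section CoordinateRing

variable (k) in
/-- The homomorphism from `k[a, b, c, d]` to the center of `A` with `a, b, c, d ↦ x³, α, β, y³`. -/
def formHom : FormRing k →ₐ[k] Subalgebra.center k (A k) :=
  MvPolynomial.aeval ![⟨x k ^ 3, x_cube_mem_center⟩, ⟨α k, α_mem_center⟩, ⟨β k, β_mem_center⟩,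
    ⟨y k ^ 3, y_cube_mem_center⟩]

/-- The element `γ` of the center. -/
def γCenter (hω : 1 + ω + ω ^ 2 = 0) : Subalgebra.center k (A k) := ⟨γ k, γ_mem_center hω⟩

lemma s_mem_center (hω : IsPrimitiveRoot ω 3) : s ω ∈ Subalgebra.center k (A k) :=
  sub_mem (δ_cube_mem_center (one_add_add_sq hω)) (Subalgebra.smul_mem _ (add_mem
    (Subalgebra.smul_mem _ (mul_mem x_cube_mem_center y_cube_mem_center) _)
    (Subalgebra.smul_mem _ (mul_mem α_mem_center β_mem_center) _)) _)

/-- The elements `x³, α, β, y³, γ` are algebraically independent: their monomials are `k[α,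
β]`-multiples of the independent elements `γ ^ r x ^ (3i) y ^ (3l)`. -/
lemma polyLift_center_injective (hω : IsPrimitiveRoot ω 3) :
    Function.Injective (polyLift (formHom k) (γCenter (one_add_add_sq hω))) := by
  let f : Polynomial (FormRing k) →ₗ[k] A k :=
    (Subalgebra.center k (A k)).val.toLinearMap ∘ₗ
      (polyLift (formHom k) (γCenter (one_add_add_sq hω))).toLinearMap
  suffices h : Function.Injective f from Function.Injective.of_comp (f := Subtype.val) h
  let b := (MvPolynomial.basisMonomials (Fin 4) k).smulTower
    (Polynomial.basisMonomials (FormRing k))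
  refine injective_of_linearIndependent_basis b f ?_
  have hli := linearIndependent_smul (MvPolynomial.basisMonomials (Fin 2) k).linearIndependent
    (linearIndependent_γ_pow_mul_mono hω)
  let g : (Fin 4 →₀ ℕ) × ℕ → (Fin 2 →₀ ℕ) × (ℕ × ℕ × ℕ) := fun t ↦
    (Finsupp.equivFunOnFinite.symm ![t.1 1, t.1 2], (t.2, t.1 0, t.1 3))
  have hg : g.Injective := by
    rintro ⟨a, r⟩ ⟨a', r'⟩ h
    simp only [g, Prod.mk.injEq, EmbeddingLike.apply_eq_iff_eq, Matrix.vecCons_inj] at h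
    obtain ⟨⟨h1, h2, -⟩, rfl, h0, h3⟩ := h
    refine Prod.ext (Finsupp.ext fun i ↦ ?_) rfl
    fin_cases i <;> assumption
  suffices h : (fun i ↦ f (b i)) = (fun p : (Fin 2 →₀ ℕ) × (ℕ × ℕ × ℕ) ↦
      MvPolynomial.basisMonomials (Fin 2) k p.1 •
        (γ k ^ p.2.1 * mono ω (3 * p.2.2.1) 0 (3 * p.2.2.2))) ∘ g by
    rw [h]
    exact hli.comp g hg
  ext1 ⟨a, r⟩
  have h1 : (MvPolynomial.monomial (Finsupp.equivFunOnFinite.symm ![a 1, a 2]) 1 : CoeffRing k)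
      = MvPolynomial.X 0 ^ a 1 * MvPolynomial.X 1 ^ a 2 := by
    rw [MvPolynomial.monomial_eq, Finsupp.prod_fintype _ _ (by simp)]
    simp
  have h2 : b (a, r) = Polynomial.C (MvPolynomial.X 0 ^ a 0 * MvPolynomial.X 1 ^ a 1
      * MvPolynomial.X 2 ^ a 2 * MvPolynomial.X 3 ^ a 3) * Polynomial.X ^ r := by
    simp only [b, Module.Basis.smulTower_apply, MvPolynomial.coe_basisMonomials,
      Polynomial.coe_basisMonomials]
    rw [MvPolynomial.monomial_eq, Finsupp.prod_fintype _ _ (by simp), Polynomial.smul_monomial,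
      ← Polynomial.C_mul_X_pow_eq_monomial]
    simp [Fin.prod_univ_four]
  have h0 (m n : ℕ) (z : A k) : (MvPolynomial.X 0 ^ m * MvPolynomial.X 1 ^ n : CoeffRing k) • z
      = α k ^ m * (β k ^ n * z) := by
    have hα : algebraMap (CoeffRing k) (A k) (MvPolynomial.X 0) = α k := by
      rw [Algebra.algebraMap_eq_smul_one, X_zero_smul, mul_one]
    have hβ : algebraMap (CoeffRing k) (A k) (MvPolynomial.X 1) = β k := by
      rw [Algebra.algebraMap_eq_smul_one, X_one_smul, mul_one]
    rw [Algebra.smul_def, map_mul, map_pow, map_pow, hα, hβ, mul_assoc]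
  have hcomm (a b c d e : Subalgebra.center k (A k)) (i j l m n : ℕ) :
      a ^ i * b ^ j * c ^ l * d ^ m * e ^ n = b ^ j * (c ^ l * (e ^ n * (a ^ i * d ^ m))) := by
    ring
  have h3 := congrArg Subtype.val (hcomm ⟨x k ^ 3, x_cube_mem_center⟩ ⟨α k, α_mem_center⟩
    ⟨β k, β_mem_center⟩ ⟨y k ^ 3, y_cube_mem_center⟩ (γCenter (one_add_add_sq hω))
    (a 0) (a 1) (a 2) (a 3) r)
  simp only [Function.comp_apply, g, MvPolynomial.coe_basisMonomials, h1, h0, f, h2,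
    AlgHom.toLinearMap_apply, LinearMap.comp_apply, map_mul, map_pow, polyLift_C, polyLift_X,
    Subalgebra.coe_val, formHom, MvPolynomial.aeval_X, mono, pow_mul, pow_zero, mul_one]
  exact h3

lemma s_sq_center (h2 : (2 : k) ≠ 0) (hω : IsPrimitiveRoot ω 3) :
    (⟨s ω, s_mem_center hω⟩ : Subalgebra.center k (A k)) ^ 2
      = γCenter (one_add_add_sq hω) ^ 3 + formHom k (curve k).a₆ := by
  apply Subtype.ext
  refine (s_sq h2 (one_add_add_sq hω)).trans ?_
  simp only [Algebra.smul_def, algebraMap_coeffRing]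
  have key := map_curve_a₆ (T := Subalgebra.center k (A k)) (formHom k) (coeffHom k)
    (by simp [formHom, coeffHom]) (by simp [formHom, coeffHom])
  simp only [formHom, MvPolynomial.aeval_X, Matrix.cons_val] at key
  exact congrArg (γ k ^ 3 + ·) (congrArg Subtype.val key.symm)

/-- The homomorphism from the coordinate ring of `t² = g³ + Δ(a, b, c, d) / 4` to the center that
sends `a, b, c, d, g, t` to `x³, α, β, y³, γ, s`. -/
def coordHom (h2 : (2 : k) ≠ 0) (hω : IsPrimitiveRoot ω 3) :
    (curve k).CoordinateRing →ₐ[k] Subalgebra.center k (A k) :=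
  curveLift (formHom k) (γCenter (one_add_add_sq hω)) ⟨s ω, s_mem_center hω⟩ (s_sq_center h2 hω)

lemma coordHom_algebraMap (h2 : (2 : k) ≠ 0) (hω : IsPrimitiveRoot ω 3) (c : FormRing k) :
    coordHom h2 hω (algebraMap _ _ c) = formHom k c :=
  curveLift_algebraMap (s_sq_center h2 hω) c

lemma coordHom_curveγ (h2 : (2 : k) ≠ 0) (hω : IsPrimitiveRoot ω 3) :
    coordHom h2 hω (curveγ k) = γCenter (one_add_add_sq hω) :=
  curveLift_curveγ (s_sq_center h2 hω)

lemma coordHom_curveS (h2 : (2 : k) ≠ 0) (hω : IsPrimitiveRoot ω 3) :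
    coordHom h2 hω (curveS k) = ⟨s ω, s_mem_center hω⟩ :=
  curveLift_curveS (s_sq_center h2 hω)

lemma coordHom_injective (h2 : (2 : k) ≠ 0) (hω : IsPrimitiveRoot ω 3) :
    Function.Injective (coordHom h2 hω) :=
  curveLift_injective (s_sq_center h2 hω) (polyLift_center_injective hω)

/-- The generator `δ³` of the center is obtained from `s` by the definition of `s`. -/
lemma coordHom_surjective (h2 : (2 : k) ≠ 0) (hω : IsPrimitiveRoot ω 3) :
    Function.Surjective (coordHom h2 hω) := by
  let S : Subalgebra k (A k) := (coordHom h2 hω).range.map (Subalgebra.center k (A k)).val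
  have hX (i : Fin 4) : (formHom k (MvPolynomial.X i) : A k) ∈ S :=
    ⟨_, ⟨_, coordHom_algebraMap h2 hω (MvPolynomial.X i)⟩, rfl⟩
  have hx : x k ^ 3 ∈ S := by simpa [formHom] using hX 0
  have hα : α k ∈ S := by simpa [formHom] using hX 1
  have hβ : β k ∈ S := by simpa [formHom] using hX 2
  have hy : y k ^ 3 ∈ S := by simpa [formHom] using hX 3
  have hγ : γ k ∈ S := ⟨_, ⟨_, coordHom_curveγ h2 hω⟩, rfl⟩
  have hs : s ω ∈ S := ⟨_, ⟨_, coordHom_curveS h2 hω⟩, rfl⟩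
  have hδ : δ ω ^ 3 ∈ S := by
    have := add_mem hs (S.smul_mem (add_mem (S.smul_mem (mul_mem hx hy) (3 * ω * (1 - ω)))
      (S.smul_mem (mul_mem hα hβ) (1 + 2 * ω ^ 2))) 2⁻¹)
    rwa [s, sub_add_cancel] at this
  have hS : Subalgebra.center k (A k) ≤ S := by
    rw [center_eq_centerGen hω, centerGen, Algebra.adjoin_le_iff]
    rintro _ (rfl | rfl | rfl | rfl | rfl | rfl) <;> assumption
  rintro ⟨z, hz⟩
  obtain ⟨_, ⟨a, rfl⟩, ha⟩ := hS hz
  exact ⟨a, Subtype.ext ha⟩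

end CoordinateRing

/-! ### Base change and fibres of Weierstrass curves -/

section BaseChange

variable {R S : Type u} [CommRing R] [CommRing S]

open WeierstrassCurve.Affine in
lemma coordinateRing_hom_ext {T : Type*} [CommRing T] {W : WeierstrassCurve.Affine R}
    {f g : W.CoordinateRing →+* T} (hC : ∀ r : R, f (algebraMap R _ r) = g (algebraMap R _ r))
    (hX : f (CoordinateRing.mk W (Polynomial.C Polynomial.X))
      = g (CoordinateRing.mk W (Polynomial.C Polynomial.X)))
    (hY : f (CoordinateRing.mk W Polynomial.X) = g (CoordinateRing.mk W Polynomial.X)) :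
    f = g := by
  refine Ideal.Quotient.ringHom_ext (Polynomial.ringHom_ext' (Polynomial.ringHom_ext' ?_ ?_) ?_)
  · exact RingHom.ext hC
  · exact hX
  · exact hY

open WeierstrassCurve.Affine in
lemma coordinateRing_equation (W : WeierstrassCurve.Affine R) :
    CoordinateRing.mk W Polynomial.X ^ 2
      + algebraMap R _ W.a₁ * CoordinateRing.mk W (Polynomial.C Polynomial.X)
        * CoordinateRing.mk W Polynomial.X
      + algebraMap R _ W.a₃ * CoordinateRing.mk W Polynomial.X
    = CoordinateRing.mk W (Polynomial.C Polynomial.X) ^ 3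
      + algebraMap R _ W.a₂ * CoordinateRing.mk W (Polynomial.C Polynomial.X) ^ 2
      + algebraMap R _ W.a₄ * CoordinateRing.mk W (Polynomial.C Polynomial.X)
      + algebraMap R _ W.a₆ := by
  have h : CoordinateRing.mk W W.polynomial = 0 := AdjoinRoot.mk_self
  have hr (r : R) : algebraMap R W.CoordinateRing r
      = CoordinateRing.mk W (Polynomial.C (Polynomial.C r)) := rfl
  simp only [polynomial, map_add, map_sub, map_mul, map_pow] at h
  simp only [hr]
  linear_combination h

open WeierstrassCurve.Affine in
lemma exists_coordinateRing_lift {T : Type*} [CommRing T] (W : WeierstrassCurve.Affine R)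
    (f : R →+* T) (X Y : T) (h : Y ^ 2 + f W.a₁ * X * Y + f W.a₃ * Y
      = X ^ 3 + f W.a₂ * X ^ 2 + f W.a₄ * X + f W.a₆) :
    ∃ F : W.CoordinateRing →+* T, (∀ r, F (algebraMap R _ r) = f r) ∧
      F (CoordinateRing.mk W (Polynomial.C Polynomial.X)) = X ∧
      F (CoordinateRing.mk W Polynomial.X) = Y := by
  refine ⟨AdjoinRoot.lift (Polynomial.eval₂RingHom f X) Y ?_, fun r ↦ ?_, ?_, ?_⟩
  · simp only [polynomial, Polynomial.eval₂_add, Polynomial.eval₂_sub, Polynomial.eval₂_mul,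
      Polynomial.eval₂_pow, Polynomial.eval₂_X, Polynomial.eval₂_C, Polynomial.coe_eval₂RingHom]
    linear_combination h
  · refine (AdjoinRoot.lift_mk _ (Polynomial.C (Polynomial.C r))).trans ?_
    simp
  · refine (AdjoinRoot.lift_mk _ (Polynomial.C Polynomial.X)).trans ?_
    simp
  · refine (AdjoinRoot.lift_mk _ Polynomial.X).trans ?_
    simp

open WeierstrassCurve.Affine in
/-- The formation of the coordinate ring of a Weierstrass curve commutes with base change: both
sides classify solutions of the Weierstrass equation. -/
lemma isPushout_coordinateRing (W : WeierstrassCurve.Affine R) (φ : R →+* S) :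
    IsPushout (CommRingCat.ofHom (algebraMap R W.CoordinateRing)) (CommRingCat.ofHom φ)
      (CommRingCat.ofHom (CoordinateRing.map W φ))
      (CommRingCat.ofHom (algebraMap S (W.map φ).toAffine.CoordinateRing)) := by
  have hC (r : R) : CoordinateRing.map W φ (algebraMap R _ r) = algebraMap S _ (φ r) := by
    refine (CoordinateRing.map_mk φ (Polynomial.C (Polynomial.C r))).trans ?_
    simp
    rfl
  have hX : CoordinateRing.map W φ (CoordinateRing.mk W (Polynomial.C Polynomial.X))
      = CoordinateRing.mk (W.map φ).toAffine (Polynomial.C Polynomial.X) := by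
    rw [CoordinateRing.map_mk]
    simp
  have hY : CoordinateRing.map W φ (CoordinateRing.mk W Polynomial.X)
      = CoordinateRing.mk (W.map φ).toAffine Polynomial.X := by
    rw [CoordinateRing.map_mk]
    simp
  refine ⟨⟨?_⟩, ⟨?_⟩⟩
  · ext r
    exact hC r
  have hs (s : Limits.PushoutCocone (CommRingCat.ofHom (algebraMap R W.CoordinateRing))
      (CommRingCat.ofHom φ)) (r : R) : s.inr.hom (φ r) = s.inl.hom (algebraMap R _ r) :=
    (ConcreteCategory.congr_hom s.condition r).symm
  have key (s : Limits.PushoutCocone (CommRingCat.ofHom (algebraMap R W.CoordinateRing))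
      (CommRingCat.ofHom φ)) :
      ∃ F : (W.map φ).toAffine.CoordinateRing →+* s.pt, (∀ r, F (algebraMap S _ r) = s.inr.hom r) ∧
        F (CoordinateRing.mk _ (Polynomial.C Polynomial.X))
          = s.inl.hom (CoordinateRing.mk W (Polynomial.C Polynomial.X)) ∧
        F (CoordinateRing.mk _ Polynomial.X) = s.inl.hom (CoordinateRing.mk W Polynomial.X) := by
    refine exists_coordinateRing_lift _ s.inr.hom _ _ ?_
    have := congrArg s.inl.hom (coordinateRing_equation W)
    simp only [map_add, map_mul, map_pow] at this
    simpa only [WeierstrassCurve.map_a₁, WeierstrassCurve.map_a₂, WeierstrassCurve.map_a₃,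
      WeierstrassCurve.map_a₄, WeierstrassCurve.map_a₆, hs s] using this
  choose F hF using key
  refine Limits.PushoutCocone.IsColimit.mk _ (fun s ↦ CommRingCat.ofHom (F s)) (fun s ↦ ?_)
    (fun s ↦ ?_) fun s m h₁ h₂ ↦ ?_
  · refine CommRingCat.hom_ext (coordinateRing_hom_ext (fun r ↦ ?_) ?_ ?_)
    · change F s (CoordinateRing.map W φ (algebraMap R _ r)) = _
      rw [hC, (hF s).1, hs s]
    · change F s (CoordinateRing.map W φ _) = _
      rw [hX, (hF s).2.1]
    · change F s (CoordinateRing.map W φ _) = _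
      rw [hY, (hF s).2.2]
  · exact CommRingCat.hom_ext (RingHom.ext (hF s).1)
  · refine CommRingCat.hom_ext (coordinateRing_hom_ext (fun r ↦ ?_) ?_ ?_)
    · exact (ConcreteCategory.congr_hom h₂ r).trans ((hF s).1 r).symm
    · change m.hom _ = F s _
      rw [(hF s).2.1, ← h₁, ← hX]
      rfl
    · change m.hom _ = F s _
      rw [(hF s).2.2, ← h₁, ← hY]
      rfl

end BaseChange

section KrullDimension

/-- An integral extension of domains, with base a principal ideal domain that is not a field, has
dimension one. -/
lemma ringKrullDim_eq_one_of_isIntegral (R S : Type*) [CommRing R] [IsDomain R]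
    [IsPrincipalIdealRing R] [CommRing S] [IsDomain S] [Algebra R S] [Algebra.IsIntegral R S]
    (hR : ¬ IsField R) (hinj : Function.Injective (algebraMap R S)) : ringKrullDim S = 1 := by
  have h1 : Ring.KrullDimLE 1 S := by
    refine Ring.KrullDimLE.mk₁' fun I hI hp ↦ ?_
    have hc : I.comap (algebraMap R S) ≠ ⊥ := by
      obtain ⟨a, ha, ha0⟩ := Submodule.exists_mem_ne_zero_of_ne_bot hI
      exact Ideal.comap_ne_bot_of_integral_mem ha0 ha (Algebra.IsIntegral.isIntegral a)
    have := (Ideal.IsPrime.comap (algebraMap R S) (K := I)).isMaximal_of_ne_bot hc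
    exact Ideal.isMaximal_of_isIntegral_of_isMaximal_comap (R := R) I this
  refine eq_of_le_of_not_lt (by simpa using (Ring.krullDimLE_iff).1 h1) fun h ↦ hR ?_
  have h' : ringKrullDim S ≤ 0 := Order.le_of_lt_succ h
  rw [← Nat.cast_zero, ← Ring.krullDimLE_iff] at h'
  exact isField_of_isIntegral_of_isField hinj Ring.KrullDimLE.isField_of_isDomain

lemma ringKrullDim_coordinateRing {K : Type*} [Field K] (W : WeierstrassCurve.Affine K) :
    ringKrullDim W.CoordinateRing = 1 := by
  have : Module.Finite (Polynomial K) W.CoordinateRing :=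
    .of_basis (WeierstrassCurve.Affine.CoordinateRing.basis W)
  exact ringKrullDim_eq_one_of_isIntegral (Polynomial K) _ (Polynomial.not_isField K)
    (FaithfulSMul.algebraMap_injective _ _)

end KrullDimension

section RelativeCurve

variable {R : Type u} [CommRing R] (W : WeierstrassCurve.Affine R)

instance : Algebra.FinitePresentation R W.CoordinateRing := by
  have : Algebra.FinitePresentation (Polynomial R) W.CoordinateRing :=
    .quotient ⟨{W.polynomial}, by simp⟩
  exact .trans R (Polynomial R) _

/-- The base change of an affine Weierstrass curve to an affine scheme is the affine Weierstrass
curve with the coefficients mapped along. -/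
lemma exists_iso_of_isPullback {S : Type u} [CommRing S] {Z : Scheme.{u}}
    {g : Spec (.of S) ⟶ Spec (.of R)} {fst : Z ⟶ Spec (.of W.CoordinateRing)}
    {snd : Z ⟶ Spec (.of S)} (h : IsPullback fst snd (affineCurveHom W) g) :
    ∃ φ : Z ≅ Spec (.of (W.map (Spec.preimage g).hom).toAffine.CoordinateRing),
      φ.hom ≫ affineCurveHom (W.map (Spec.preimage g).hom) = snd := by
  have hp := isPullback_SpecMap_of_isPushout _ _ _ _
    (isPushout_coordinateRing W (Spec.preimage g).hom)
  rw [CommRingCat.ofHom_hom, Spec.map_preimage] at hp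
  exact ⟨h.isoIsPullback _ _ hp, h.isoIsPullback_hom_snd _ _ hp⟩

theorem isRelativeAffineCurve_affineCurveHom : IsRelativeAffineCurve (affineCurveHom W) where
  isAffineHom := by rw [affineCurveHom]; infer_instance
  flat := by
    rw [affineCurveHom, HasRingHomProperty.Spec_iff (P := @Flat)]
    exact (RingHom.flat_algebraMap_iff).2 inferInstance
  locallyOfFinitePresentation := by
    rw [affineCurveHom, HasRingHomProperty.Spec_iff (P := @LocallyOfFinitePresentation)]
    exact (RingHom.finitePresentation_algebraMap).2 inferInstance
  geometricallyIntegral := ⟨fun K _ y Z fst snd h ↦ by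
    obtain ⟨φ, -⟩ := exists_iso_of_isPullback W h
    have : Nonempty Z := ⟨φ.inv (Nonempty.some inferInstance)⟩
    exact isIntegral_of_isOpenImmersion φ.hom⟩
  dimension_fiber p := by
    obtain ⟨φ, -⟩ := exists_iso_of_isPullback W
      (IsPullback.of_hasPullback (affineCurveHom W)
        ((Spec (.of R)).fromSpecResidueField p))
    refine (IsHomeomorph.topologicalKrullDim_eq _ (Scheme.homeoOfIso φ).isHomeomorph).trans ?_
    let : Field ((Spec (.of R)).residueField p) := inferInstance
    exact (PrimeSpectrum.topologicalKrullDim_eq_ringKrullDim _).trans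
      (ringKrullDim_coordinateRing _)

end RelativeCurve

/-! ### Discriminants of binary cubic forms -/

section Discriminant

lemma discr_map {R S : Type*} [CommRing R] [CommRing S] (φ : R →+* S) (f : Cubic R) :
    (f.map φ).discr = φ f.discr := by
  simp only [Cubic.discr, Cubic.map, map_add, map_sub, map_mul, map_pow, map_ofNat]

/-- Dehomogenising at `v = 1` recovers all four coefficients. -/
lemma binaryForm_injective {R : Type u} [CommRing R] :
    Function.Injective (binaryForm : Cubic R → MvPolynomial (Fin 2) R) := by
  intro f g h
  have h' := congrArg (MvPolynomial.aeval ![(Polynomial.X : Polynomial R), 1]) h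
  simp only [binaryForm, map_add, map_mul, map_pow, MvPolynomial.aeval_X, MvPolynomial.aeval_C,
    Matrix.cons_val_zero, Matrix.cons_val_one, one_pow, mul_one] at h'
  exact (Cubic.toPoly_injective f g).1 h'

lemma binaryForm_eq_prod {R : Type u} [CommRing R] (p q : Fin 3 → R) :
    binaryForm ⟨p 0 * p 1 * p 2, p 0 * p 1 * q 2 + p 0 * q 1 * p 2 + q 0 * p 1 * p 2,
      p 0 * q 1 * q 2 + q 0 * p 1 * q 2 + q 0 * q 1 * p 2, q 0 * q 1 * q 2⟩ =
      ∏ i, (MvPolynomial.C (p i) * MvPolynomial.X 0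
        + MvPolynomial.C (q i) * MvPolynomial.X 1) := by
  simp only [binaryForm, Fin.prod_univ_three, map_add, map_mul]
  ring

variable {K : Type u} [Field K]

/-- A binary cubic form of nonzero discriminant over an algebraically closed field is a product of
three linear forms. If the coefficient `a` of `u³` vanishes, then `v` is one of them. -/
lemma exists_linear_factors [IsAlgClosed K] {f : Cubic K} (hf : f.discr ≠ 0) :
    ∃ p q : Fin 3 → K, f = ⟨p 0 * p 1 * p 2, p 0 * p 1 * q 2 + p 0 * q 1 * p 2 + q 0 * p 1 * p 2,
      p 0 * q 1 * q 2 + q 0 * p 1 * q 2 + q 0 * q 1 * p 2, q 0 * q 1 * q 2⟩ := by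
  obtain ⟨a, b, c, d⟩ := f
  by_cases ha : a = 0
  · by_cases hb : b = 0
    · simp [Cubic.discr, ha, hb] at hf
    obtain ⟨r, hr⟩ := IsAlgClosed.exists_root
      (Polynomial.C b * Polynomial.X ^ 2 + Polynomial.C c * Polynomial.X + Polynomial.C d)
      (by rw [Polynomial.degree_quadratic hb]; decide)
    have hr' : b * r ^ 2 + c * r + d = 0 := by simpa using hr
    refine ⟨![0, 1, b], ![1, -r, c + b * r], ?_⟩
    ext <;> simp [ha]
    · ring
    · linear_combination hr'
  · obtain ⟨z₁, z₂, z₃, hz⟩ := (Cubic.splits_iff_roots_eq_three (P := ⟨a, b, c, d⟩)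
      (φ := RingHom.id K) ha).1 (IsAlgClosed.splits _)
    refine ⟨![a, 1, 1], ![-(a * z₁), -z₂, -z₃], ?_⟩
    have h := Cubic.eq_sum_three_roots (φ := RingHom.id K) ha hz
    simp only [Cubic.map, RingHom.id_apply] at h
    rw [h]
    ext <;> simp <;> ring

theorem isNondegenerate_iff (f : Cubic K) : IsNondegenerate f ↔ f.discr ≠ 0 := by
  have hd : ∀ p q : Fin 3 → AlgebraicClosure K,
      Cubic.discr ⟨p 0 * p 1 * p 2, p 0 * p 1 * q 2 + p 0 * q 1 * p 2 + q 0 * p 1 * p 2,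
        p 0 * q 1 * q 2 + q 0 * p 1 * q 2 + q 0 * q 1 * p 2, q 0 * q 1 * q 2⟩
      = ((p 0 * q 1 - p 1 * q 0) * (p 0 * q 2 - p 2 * q 0) * (p 1 * q 2 - p 2 * q 1)) ^ 2 := by
    intro p q
    simp only [Cubic.discr]
    ring
  have hf : f.discr ≠ 0 ↔ (f.map (algebraMap K (AlgebraicClosure K))).discr ≠ 0 := by
    rw [discr_map]
    exact (map_ne_zero _).symm
  rw [hf]
  constructor
  · rintro ⟨p, q, hpq, h⟩
    rw [← binaryForm_eq_prod] at h
    rw [binaryForm_injective h, hd]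
    have h01 := sub_ne_zero.2 (hpq 0 1 (by decide))
    have h02 := sub_ne_zero.2 (hpq 0 2 (by decide))
    have h12 := sub_ne_zero.2 (hpq 1 2 (by decide))
    exact pow_ne_zero 2 (mul_ne_zero (mul_ne_zero h01 h02) h12)
  · intro h
    obtain ⟨p, q, e⟩ := exists_linear_factors h
    refine ⟨p, q, ?_, by rw [e, binaryForm_eq_prod]⟩
    rw [e, hd] at h
    intro i j hij hpq
    apply h
    fin_cases i <;> fin_cases j <;> simp at hij hpq <;> simp [hpq]

end Discriminant

/-! ### The nondegenerate locus and the elliptic curve over it -/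

section GenericForm

variable {k : Type u} [Field k]

lemma nondegenerateLocus_eq : nondegenerateLocus k =
    (PrimeSpectrum.basicOpen (genericForm k).discr : Set (PrimeSpectrum (FormRing k))) := by
  ext p
  change PrimeSpectrum (FormRing k) at p
  change IsNondegenerate ((genericForm k).map (algebraMap _ p.asIdeal.ResidueField)) ↔
    (genericForm k).discr ∉ p.asIdeal
  rw [isNondegenerate_iff, discr_map, Ne, Ideal.algebraMap_residueField_eq_zero]

/-- The form `u²v + uv²` has discriminant `1`. -/
lemma discr_genericForm_ne_zero : (genericForm k).discr ≠ 0 := by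
  intro h
  have := congrArg (MvPolynomial.aeval ![(0 : k), 1, 1, 0]) h
  simp [Cubic.discr, genericForm] at this

lemma dense_basicOpen {R : Type*} [CommRing R] [IsDomain R] {r : R} (hr : r ≠ 0) :
    Dense (PrimeSpectrum.basicOpen r : Set (PrimeSpectrum R)) :=
  (PrimeSpectrum.basicOpen r).isOpen.dense
    ⟨⊥, fun h ↦ hr (by simpa using h)⟩

/-- The curve `y² = x³ + a₆` has discriminant `-432 a₆²`; the constant here equals `-27`. -/
lemma Δ_curve :
    (curve k).Δ = MvPolynomial.C (-432 * (4 : k)⁻¹ ^ 2) * (genericForm k).discr ^ 2 := by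
  simp only [WeierstrassCurve.Δ, WeierstrassCurve.b₂, WeierstrassCurve.b₄, WeierstrassCurve.b₆,
    WeierstrassCurve.b₈, curve, map_mul, map_neg, map_pow, map_ofNat]
  ring

lemma isUnit_map_Δ_curve (h2 : (2 : k) ≠ 0) (h3 : (3 : k) ≠ 0) {S : Type*} [CommRing S]
    (φ : FormRing k →+* S) (h : IsUnit (φ (genericForm k).discr)) : IsUnit (φ (curve k).Δ) := by
  have h4 : (-432 * (4 : k)⁻¹ ^ 2 : k) ≠ 0 := by
    have e4 : (4 : k) = 2 ^ 2 := by norm_num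
    have e432 : (-432 : k) = -(2 ^ 4 * 3 ^ 3) := by norm_num
    rw [e4, e432]
    simp [h2, h3]
  rw [Δ_curve, map_mul, map_pow]
  exact ((h4.isUnit.map MvPolynomial.C).map φ).mul (h.pow 2)

lemma isUnit_Δ_curveOn (h2 : (2 : k) ≠ 0) (h3 : (3 : k) ≠ 0) {U : (FormSpace k).Opens}
    (hU : U = PrimeSpectrum.basicOpen (genericForm k).discr) : IsUnit (curveOn k U).Δ := by
  have hU' : U = (FormSpace k).basicOpen
      ((Scheme.ΓSpecIso (CommRingCat.of (FormRing k))).inv (genericForm k).discr) :=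
    hU.trans (basicOpen_eq_of_affine (R := CommRingCat.of (FormRing k)) _).symm
  have h : IsUnit (((Scheme.ΓSpecIso (CommRingCat.of (FormRing k))).inv ≫
      (FormSpace k).presheaf.map (homOfLE (le_top : U ≤ ⊤)).op).hom (genericForm k).discr) := by
    subst hU'
    exact RingedSpace.isUnit_res_basicOpen _ _
  rw [curveOn, WeierstrassCurve.map_Δ]
  exact isUnit_map_Δ_curve h2 h3 _ h

end GenericForm

section Elliptic

/-- Over an affine open `U`, an affine Weierstrass curve is the one over the ring of functions on
`U`. -/
lemma exists_iso_morphismRestrict {R : Type u} [CommRing R] (W : WeierstrassCurve.Affine R)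
    {U : (Spec (.of R)).Opens} (hU : IsAffineOpen U) :
    ∃ φ : (affineCurveHom W ⁻¹ᵁ U).toScheme ≅ Spec (.of (WeierstrassCurve.Affine.CoordinateRing
        (WeierstrassCurve.map W ((Scheme.ΓSpecIso (CommRingCat.of R)).inv ≫
          (Spec (.of R)).presheaf.map (homOfLE le_top).op).hom))),
      φ.hom ≫ affineCurveHom _ = (affineCurveHom W ∣_ U) ≫ U.toSpecΓ := by
  have : IsIso U.toSpecΓ := inferInstanceAs (IsIso hU.isoSpec.hom)
  have h := (isPullback_morphismRestrict (affineCurveHom W) U).flip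
  let g := Spec.map ((Scheme.ΓSpecIso (CommRingCat.of R)).inv ≫
    (Spec (.of R)).presheaf.map (homOfLE (le_top : U ≤ ⊤)).op)
  have hg : U.toSpecΓ ≫ g = U.ι := by
    simp only [g, Spec.map_comp]
    rw [Scheme.Opens.toSpecΓ_SpecMap_presheaf_map_top_assoc]
    simp
  have hp := isPullback_SpecMap_of_isPushout _ _ _ _
    (isPushout_coordinateRing W ((Scheme.ΓSpecIso (CommRingCat.of R)).inv ≫
      (Spec (.of R)).presheaf.map (homOfLE (le_top : U ≤ ⊤)).op).hom)
  have h' : IsPullback (affineCurveHom W ⁻¹ᵁ U).ι ((affineCurveHom W ∣_ U) ≫ U.toSpecΓ)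
      (affineCurveHom W) g :=
    h.of_iso (Iso.refl _) (Iso.refl _) (asIso U.toSpecΓ) (Iso.refl _) (by simp) (by simp)
      (by simp) (by simpa using hg.symm)
  exact ⟨h'.isoIsPullback _ _ hp, h'.isoIsPullback_hom_snd _ _ hp⟩

end Elliptic

end CubicClifford

end

theorem theorem1p1 {k : Type u} [Field k] (h2 : (2 : k) ≠ 0) (h3 : (3 : k) ≠ 0)
    (ω : k) (hω : IsPrimitiveRoot ω 3) :
    -- the center of `A` is `k[x³, y³, α, β, γ, δ³]`
    Subalgebra.center k (CubicClifford.A k) =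
      Algebra.adjoin k {CubicClifford.x k ^ 3, CubicClifford.y k ^ 3, CubicClifford.α k,
        CubicClifford.β k, CubicClifford.γ k, CubicClifford.δ ω ^ 3} ∧
    -- the center is the coordinate ring of `s² = γ³ + Δ(x³, α, β, y³) / 4`
    (∃ e : (CubicClifford.curve k).CoordinateRing ≃ₐ[k] Subalgebra.center k (CubicClifford.A k),
      (e (algebraMap (CubicClifford.FormRing k) _ (MvPolynomial.X 0)) : CubicClifford.A k)
        = CubicClifford.x k ^ 3 ∧
      (e (algebraMap (CubicClifford.FormRing k) _ (MvPolynomial.X 1)) : CubicClifford.A k)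
        = CubicClifford.α k ∧
      (e (algebraMap (CubicClifford.FormRing k) _ (MvPolynomial.X 2)) : CubicClifford.A k)
        = CubicClifford.β k ∧
      (e (algebraMap (CubicClifford.FormRing k) _ (MvPolynomial.X 3)) : CubicClifford.A k)
        = CubicClifford.y k ^ 3 ∧
      (e (CubicClifford.curveγ k) : CubicClifford.A k) = CubicClifford.γ k ∧
      (e (CubicClifford.curveS k) : CubicClifford.A k) = CubicClifford.s ω) ∧
    -- this equation defines a relative curve over affine four-space
    CubicClifford.IsRelativeAffineCurve (CubicClifford.affineCurveHom (CubicClifford.curve k)) ∧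
    -- the nondegenerate forms make up the dense open set where the discriminant is invertible,
    -- and the relative curve is elliptic over it
    ∃ U : (CubicClifford.FormSpace k).Opens,
      U = PrimeSpectrum.basicOpen (CubicClifford.genericForm k).discr ∧
      (U : Set (CubicClifford.FormSpace k)) = CubicClifford.nondegenerateLocus k ∧
      Dense (U : Set (CubicClifford.FormSpace k)) ∧
      CubicClifford.IsEllipticOver (CubicClifford.affineCurveHom (CubicClifford.curve k)) U
        (CubicClifford.curveOn k U) := by
  refine ⟨CubicClifford.center_eq_centerGen hω,
    ⟨AlgEquiv.ofBijective (CubicClifford.coordHom h2 hω)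
      ⟨CubicClifford.coordHom_injective h2 hω, CubicClifford.coordHom_surjective h2 hω⟩,
      ?_, ?_, ?_, ?_, ?_, ?_⟩,
    CubicClifford.isRelativeAffineCurve_affineCurveHom _,
    PrimeSpectrum.basicOpen (CubicClifford.genericForm k).discr, rfl,
    CubicClifford.nondegenerateLocus_eq.symm,
    CubicClifford.dense_basicOpen CubicClifford.discr_genericForm_ne_zero, ?_⟩
  · exact (congrArg Subtype.val (CubicClifford.coordHom_algebraMap h2 hω _)).trans
      (by simp [CubicClifford.formHom])
  · exact (congrArg Subtype.val (CubicClifford.coordHom_algebraMap h2 hω _)).trans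
      (by simp [CubicClifford.formHom])
  · exact (congrArg Subtype.val (CubicClifford.coordHom_algebraMap h2 hω _)).trans
      (by simp [CubicClifford.formHom])
  · exact (congrArg Subtype.val (CubicClifford.coordHom_algebraMap h2 hω _)).trans
      (by simp [CubicClifford.formHom])
  · exact congrArg Subtype.val (CubicClifford.coordHom_curveγ h2 hω)
  · exact congrArg Subtype.val (CubicClifford.coordHom_curveS h2 hω)
  · have hU : IsAffineOpen (X := CubicClifford.FormSpace k)
        (PrimeSpectrum.basicOpen (CubicClifford.genericForm k).discr) :=
      IsAffineOpen.Spec_basicOpen (R := .of (CubicClifford.FormRing k)) _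
    exact ⟨hU, ⟨CubicClifford.isUnit_Δ_curveOn h2 h3 rfl⟩,
      CubicClifford.exists_iso_morphismRestrict (CubicClifford.curve k) hU⟩
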